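/- Let $M=(m_{st})$ be a Coxeter matrix on a set $S$ with Coxeter group $W$. Weyl data $\mathcal W$ of type $M$ consists of a set of chambers; for each $s\in S$, a groupoid (the panel groupoid of type $s$) whose vertex set is the set of chambers; and, for all $s\ne t$ in $S$ with $m_{st}<\infty$, a set of $(s,t)$-cycles, called defining $(s,t)$-suites. Here the edges (of type $s$) of $\mathcal W$ are the non-identity edges of the panel groupoids, a gallery is a finite path of edges, its type is the word of the types of its edges, its $W$-length is the element of $W$ represented by its type, and an $(s,t)$-cycle is a closed gallery of type $stst\cdots$ of length $2m_{st}$. Two galleries are homotopic if they are related by a finite sequence of the following alterations of subgalleries and their inverses: delete an edge followed by its inverse; replace two consecutive edges of the same type, not mutually inverse, by their composition in the panel groupoid; delete a defining suite. The fundamental groupoid $\overline{\mathcal W}$ has the chambers as vertices and the homotopy classes of galleries as edges. An $(s,t)$-suite is an $(s,t)$-cycle (with $s\neq t$, $m_{st}<\infty$) that is homotopic to a trivial gallery. A geodesic is a gallery whose type is a reduced word, and a maximal $(s,t)$-geodesic ($s\ne t$, $m_{st}<\infty$) is a gallery of type $stst\cdots$ of length $m_{st}$. $\mathcal W$ is a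 Weyl graph if (PW0) no connected component of a panel groupoid is the trivial groupoid with one edge; (PW1) each maximal $(s,t)$-geodesic is homotopic to a maximal $(t,s)$-geodesic; (W) homotopic geodesics have the same $W$-length. For $J\subseteq S$, the $J$-restriction $\mathcal W_J$ is the Weyl data over $J$ with the same chambers, the panel groupoids of types $s\in J$, and the defining $(s,t)$-suites of $\mathcal W$ with $s,t\in J$. Let $\mathcal W_J^{\mathrm{sat}}$ be the same with, as defining suites, all $(s,t)$-suites of $\mathcal W$ with $s,t\in J$. The $J$-residue at a chamber $C$, in either version, is the connected component of $C$ in the $J$-restriction. A homomorphism of groupoids is an embedding if it is injective on edges. **Corollary.** Let $\mathcal W$ be a Weyl graph of type $M$ over $S$, and let $J\subseteq S$. 1. The internal homomorphism $\overline{\mathcal W_J^{\mathrm{sat}}}\to\overline{\mathcal W}$, $[\beta]\mapsto[\beta]$, is an embedding; and any two geodesics in a $J$-residue of $\mathcal W_J^{\mathrm{sat}}$ which are homotopic in $\mathcal W$ are homotopic in that residue. 2. The internal homomorphism $\overline{\mathcal W_J}\to\overline{\mathcal W}$, $[\beta]\mapsto[\beta]$, is an embedding if and only if $\mathcal W_J$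 satisfies (PW1). In this case, any two geodesics in a $J$-residue of $\mathcal W_J$ which are homotopic in $\mathcal W$ are homotopic in that residue. -/

import Mathlib

open CategoryTheory

universe u v u₁ v₁ u₃

/-! ### Words and Coxeter matrices -/

/-- The alternating word `s t s t ⋯` of length `m` which begins with the letter `s`. -/
def altWord {S : Type*} (s t : S) : ℕ → List S
  | 0 => []
  | m + 1 => s :: altWord t s m

theorem altWord_map {S : Type*} {S' : Type*} (f : S' → S) (s t : S') (m : ℕ) :
    (altWord s t m).map f = altWord (f s) (f t) m := by
  induction m generalizing s t with
  | zero => rfl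
  | succ m ih => simp [altWord, ih]

/-- The restriction of a Coxeter matrix on `S` to a subset `J` of `S`.
(An entry `0` of a Coxeter matrix stands for `∞`.) -/
def CoxeterMatrix.restrict {S : Type*} (M : CoxeterMatrix S) (J : Set S) : CoxeterMatrix J where
  M := fun s t => M s t
  isSymm := by ext s t; exact M.symmetric t s
  diagonal := fun s => M.diagonal s
  off_diagonal := fun s t h => M.off_diagonal s t (fun h' => h (Subtype.ext h'))

/-! ### Generalized chamber systems and galleries -/

/-- A generalized chamber system over `S`: a set of chambers together with, for every `s : S`, a
groupoid whose set of vertices is the set of chambers (the panel groupoid of type `s`). -/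
structure GeneralizedChamberSystem (S : Type*) where
  Chamber : Type u
  panel : S → Groupoid.{v} Chamber

namespace GeneralizedChamberSystem

section
variable {S : Type*} (W : GeneralizedChamberSystem.{u, v} S)

/-- The set of edges from `x` to `y` in the panel groupoid of type `s`, trivial edges included. -/
abbrev PanelHom (s : S) (x y : W.Chamber) : Type v := (W.panel s).Hom x y

/-- The trivial edges. -/
def panelId (s : S) (x : W.Chamber) : W.PanelHom s x x := (W.panel s).id x

/-- The composition `g ; h` in the panel groupoid of type `s`. -/
def panelComp {s : S} {x y z : W.Chamber} (g : W.PanelHom s x y) (h : W.PanelHom s y z) :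
    W.PanelHom s x z := (W.panel s).comp g h

/-- The inverse in the panel groupoid of type `s`. -/
def panelInv {s : S} {x y : W.Chamber} (g : W.PanelHom s x y) : W.PanelHom s y x :=
  (W.panel s).inv g

/-- An edge of a panel groupoid is trivial if it is an identity. -/
def IsTrivial {s : S} {x y : W.Chamber} (g : W.PanelHom s x y) : Prop :=
  x = y ∧ HEq g (W.panelId s x)

theorem panelInv_panelInv {s : S} {x y : W.Chamber} (g : W.PanelHom s x y) :
    W.panelInv (W.panelInv g) = g := by
  let _ := W.panel s
  change Groupoid.inv (Groupoid.inv (show x ⟶ y from g)) = g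
  simp

theorem panelInv_panelId (s : S) (x : W.Chamber) :
    W.panelInv (W.panelId s x) = W.panelId s x := by
  let _ := W.panel s
  change Groupoid.inv (𝟙 x) = 𝟙 x
  simp

theorem panelInv_panelComp_self {s : S} {x y : W.Chamber} (g : W.PanelHom s x y) :
    W.panelComp (W.panelInv g) g = W.panelId s y := (W.panel s).inv_comp g

theorem eq_panelInv {s : S} {x y : W.Chamber} {g : W.PanelHom s x y} {h : W.PanelHom s y x}
    (hh : W.panelComp h g = W.panelId s y) : h = W.panelInv g := by
  have h₁ : W.panelComp h (W.panelComp g (W.panelInv g)) = h :=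
    (congrArg (W.panelComp h) ((W.panel s).comp_inv g)).trans ((W.panel s).comp_id h)
  have h₂ : W.panelComp (W.panelComp h g) (W.panelInv g) =
    W.panelComp h (W.panelComp g (W.panelInv g)) := (W.panel s).assoc h g (W.panelInv g)
  rw [← h₁, ← h₂, hh]
  exact (W.panel s).id_comp (W.panelInv g)

theorem not_isTrivial_panelInv {s : S} {x y : W.Chamber} {g : W.PanelHom s x y}
    (hg : ¬ W.IsTrivial g) : ¬ W.IsTrivial (W.panelInv g) := by
  rintro ⟨h, h'⟩
  subst h
  apply hg
  refine ⟨rfl, heq_of_eq ?_⟩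
  rw [← W.panelInv_panelInv g, eq_of_heq h', panelInv_panelId]

/-- An edge of the labelled graph underlying `W`: a non-trivial edge of one of the panel
groupoids. -/
structure Edge (x y : W.Chamber) where
  type : S
  hom : W.PanelHom type x y
  nontrivial : ¬ W.IsTrivial hom

instance graph : Quiver W.Chamber := ⟨W.Edge⟩

/-- The inverse of an edge in its panel groupoid. -/
instance graphHasReverse : Quiver.HasReverse W.Chamber where
  reverse' e := ⟨e.type, W.panelInv e.hom, W.not_isTrivial_panelInv e.nontrivial⟩

/-- Galleries from `x` to `y`: paths in the underlying graph, that is, finite sequences of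
consecutive edges. Concatenation is `Quiver.Path.comp`, the inverse is `Quiver.Path.reverse`. -/
abbrev Gallery (x y : W.Chamber) := Quiver.Path x y

/-- The gallery which consists of one edge. -/
def single {s : S} {x y : W.Chamber} (g : W.PanelHom s x y) (hg : ¬ W.IsTrivial g) :
    W.Gallery x y :=
  Quiver.Path.cons Quiver.Path.nil (Edge.mk s g hg)

variable {W}

/-- The type of a gallery: the sequence of the types of its edges. -/
def Gallery.types {x : W.Chamber} : {y : W.Chamber} → W.Gallery x y → List S
  | _, Quiver.Path.nil => []
  | _, Quiver.Path.cons p e => Gallery.types p ++ [Edge.type e]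

variable (W)

/-- The `J`-restriction of a generalized chamber system. -/
def restrict (J : Set S) : GeneralizedChamberSystem.{u, v} J where
  Chamber := W.Chamber
  panel := fun s => W.panel s

/-- The full subsystem on a set of chambers. -/
def full (X : Set W.Chamber) : GeneralizedChamberSystem.{u, v} S where
  Chamber := X
  panel := fun s =>
    { Hom := fun x y => (W.panel s).Hom x y
      id := fun x => (W.panel s).id x
      comp := fun g h => (W.panel s).comp g h
      id_comp := fun g => (W.panel s).id_comp g
      comp_id := fun g => (W.panel s).comp_id g
      assoc := fun g h k => (W.panel s).assoc g h k
      inv := fun g => (W.panel s).inv g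
      inv_comp := fun g => (W.panel s).inv_comp g
      comp_inv := fun g => (W.panel s).comp_inv g }

end

/-- A morphism of generalized chamber systems over a map of labels `f`: a map of chambers with,
for each label, a homomorphism of panel groupoids which has a trivial kernel. -/
structure Morphism {S' : Type*} {S : Type*} (f : S' → S)
    (V : GeneralizedChamberSystem.{u₁, v₁} S') (W : GeneralizedChamberSystem.{u, v} S) where
  chamber : V.Chamber → W.Chamber
  hom : ∀ {s : S'} {x y : V.Chamber}, V.PanelHom s x y → W.PanelHom (f s) (chamber x) (chamber y)
  hom_id : ∀ (s : S') (x : V.Chamber), hom (V.panelId s x) = W.panelId (f s) (chamber x)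
  hom_comp : ∀ {s : S'} {x y z : V.Chamber} (g : V.PanelHom s x y) (h : V.PanelHom s y z),
    hom (V.panelComp g h) = W.panelComp (hom g) (hom h)
  nontrivial : ∀ {s : S'} {x y : V.Chamber} (g : V.PanelHom s x y),
    ¬ V.IsTrivial g → ¬ W.IsTrivial (hom g)

namespace Morphism

variable {S' : Type*} {S : Type*} {f : S' → S}
  {V : GeneralizedChamberSystem.{u₁, v₁} S'} {W : GeneralizedChamberSystem.{u, v} S}

/-- The morphism of graphs which underlies a morphism of generalized chamber systems. -/
def prefunctor (ω : Morphism f V W) : V.Chamber ⥤q W.Chamber where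
  obj := ω.chamber
  map e := ⟨f e.type, ω.hom e.hom, ω.nontrivial e.hom e.nontrivial⟩

/-- The image `ω ∘ β` of a gallery under a morphism. -/
def gallery (ω : Morphism f V W) {x y : V.Chamber} (β : V.Gallery x y) :
    W.Gallery (ω.chamber x) (ω.chamber y) := ω.prefunctor.mapPath β

theorem hom_inv (ω : Morphism f V W) {s : S'} {x y : V.Chamber} (g : V.PanelHom s x y) :
    ω.hom (V.panelInv g) = W.panelInv (ω.hom g) := by
  apply W.eq_panelInv
  rw [← ω.hom_comp, V.panelInv_panelComp_self, ω.hom_id]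

theorem types_gallery (ω : Morphism f V W) {x y : V.Chamber} (β : V.Gallery x y) :
    (ω.gallery β).types = β.types.map f := by
  induction β with
  | nil => rfl
  | cons p e ih =>
    change Gallery.types (ω.gallery p) ++ [f (Edge.type e)] =
      (Gallery.types p ++ [Edge.type e]).map f
    rw [ih]; simp

theorem gallery_comp (ω : Morphism f V W) {x y z : V.Chamber} (β : V.Gallery x y)
    (β' : V.Gallery y z) :
    ω.gallery (Quiver.Path.comp β β') = Quiver.Path.comp (ω.gallery β) (ω.gallery β') :=
  Prefunctor.mapPath_comp _ β β'

end Morphism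

/-- The inclusion of the `J`-restriction. -/
def restrictInclusion {S : Type*} (W : GeneralizedChamberSystem.{u, v} S) (J : Set S) :
    Morphism (Subtype.val : J → S) (W.restrict J) W where
  chamber := fun x => x
  hom := fun g => g
  hom_id := fun _ _ => rfl
  hom_comp := fun _ _ => rfl
  nontrivial := fun _ hg => hg

/-- The inclusion of a full subsystem. -/
def fullInclusion {S : Type*} (W : GeneralizedChamberSystem.{u, v} S) (X : Set W.Chamber) :
    Morphism (id : S → S) (W.full X) W where
  chamber := Subtype.val
  hom := fun g => g
  hom_id := fun _ _ => rfl
  hom_comp := fun _ _ => rfl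
  nontrivial := by
    intro s x y g hg hg'
    obtain ⟨h, h'⟩ := hg'
    have hxy : x = y := Subtype.ext h
    subst hxy
    exact hg ⟨rfl, h'⟩

end GeneralizedChamberSystem

open GeneralizedChamberSystem

/-! ### Weyl data and homotopy -/

/-- Weyl data of type `M`: a generalized chamber system with, for all `s ≠ t` with `m_{st} < ∞`, a
set of `(s,t)`-cycles (closed galleries of type `s t s t ⋯`, of length `2 m_{st}`), called the
defining `(s,t)`-suites. `defSuite s t x` is the set of those which begin at `x`. -/
structure WeylData {S : Type*} (M : CoxeterMatrix S) extends GeneralizedChamberSystem.{u, v} S where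
  defSuite : ∀ (s t : S) (x : Chamber), Set (toGeneralizedChamberSystem.Gallery x x)
  defSuite_spec : ∀ (s t : S) (x : Chamber) (θ : toGeneralizedChamberSystem.Gallery x x),
    θ ∈ defSuite s t x → s ≠ t ∧ M s t ≠ 0 ∧ Gallery.types θ = altWord s t (2 * M s t)

namespace WeylData

section
variable {S : Type u₃} {M : CoxeterMatrix S} (W : WeylData.{u, v} M)

/-- The local moves: delete a backtrack, take a shortcut, delete a defining suite. -/
inductive Move : {x y : W.Chamber} → W.Gallery x y → W.Gallery x y → Prop
  | backtrack {s : S} {x y : W.Chamber} (g : W.PanelHom s x y) (hg : ¬ W.IsTrivial g) :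
      Move (Quiver.Path.comp (W.single g hg)
        (W.single (W.panelInv g) (W.not_isTrivial_panelInv hg))) Quiver.Path.nil
  | shortcut {s : S} {x y z : W.Chamber} (g : W.PanelHom s x y) (h : W.PanelHom s y z)
      (hg : ¬ W.IsTrivial g) (hh : ¬ W.IsTrivial h) (hgh : ¬ W.IsTrivial (W.panelComp g h)) :
      Move (Quiver.Path.comp (W.single g hg) (W.single h hh)) (W.single (W.panelComp g h) hgh)
  | suite {s t : S} {x : W.Chamber} (θ : W.Gallery x x) (hθ : θ ∈ W.defSuite s t x) :
      Move θ Quiver.Path.nil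

/-- A contraction applies a local move to a subgallery. -/
inductive Contraction {x y : W.Chamber} : W.Gallery x y → W.Gallery x y → Prop
  | mk {a b : W.Chamber} (p : W.Gallery x a) (c d : W.Gallery a b) (q : W.Gallery b y)
      (h : W.Move c d) :
      Contraction (Quiver.Path.comp p (Quiver.Path.comp c q))
        (Quiver.Path.comp p (Quiver.Path.comp d q))

/-- Homotopy of galleries: a composition of contractions and of their inverses. -/
def Homotopic {x y : W.Chamber} : W.Gallery x y → W.Gallery x y → Prop :=
  Relation.EqvGen W.Contraction

/-- A closed gallery is null-homotopic if it is homotopic to the trivial gallery. -/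
def NullHomotopic {x : W.Chamber} (θ : W.Gallery x x) : Prop :=
  W.Homotopic θ Quiver.Path.nil

/-- An `(s,t)`-suite: a null-homotopic `(s,t)`-cycle, where `s ≠ t` and `m_{st} < ∞`. -/
def IsSuite (s t : S) {x : W.Chamber} (θ : W.Gallery x x) : Prop :=
  s ≠ t ∧ M s t ≠ 0 ∧ Gallery.types θ = altWord s t (2 * M s t) ∧ W.NullHomotopic θ

/-- The `W`-length of a gallery, an element of the Coxeter group of type `M`. -/
def wLength {x y : W.Chamber} (β : W.Gallery x y) : M.Group :=
  M.toCoxeterSystem.wordProd (Gallery.types β)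

/-- A geodesic is a gallery whose type is a reduced word. -/
def IsGeodesic {x y : W.Chamber} (β : W.Gallery x y) : Prop :=
  M.toCoxeterSystem.IsReduced (Gallery.types β)

/-- A maximal `(s,t)`-geodesic is a gallery of type `s t s t ⋯`, of length `m_{st} < ∞`. -/
def IsMaxGeodesic (s t : S) {x y : W.Chamber} (ρ : W.Gallery x y) : Prop :=
  s ≠ t ∧ M s t ≠ 0 ∧ Gallery.types ρ = altWord s t (M s t)

/-- No panel is the trivial groupoid with one edge: every chamber has, in each panel groupoid, a
non-trivial edge which begins there. -/
def PW0 : Prop :=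
  ∀ (s : S) (x : W.Chamber), ∃ (y : W.Chamber) (g : W.PanelHom s x y), ¬ W.IsTrivial g

/-- Each maximal `(s,t)`-geodesic is homotopic to a maximal `(t,s)`-geodesic. -/
def PW1 : Prop :=
  ∀ (s t : S) (x y : W.Chamber) (ρ : W.Gallery x y), W.IsMaxGeodesic s t ρ →
    ∃ ρ' : W.Gallery x y, W.IsMaxGeodesic t s ρ' ∧ W.Homotopic ρ ρ'

/-- Homotopic geodesics have the same `W`-length. -/
def PropertyW : Prop :=
  ∀ (x y : W.Chamber) (γ γ' : W.Gallery x y), W.IsGeodesic γ → W.IsGeodesic γ' →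
    W.Homotopic γ γ' → W.wLength γ = W.wLength γ'

/-- Pre-Weyl graphs. -/
structure IsPreWeylGraph : Prop where
  pw0 : W.PW0
  pw1 : W.PW1

/-- Weyl graphs. -/
structure IsWeylGraph : Prop extends W.IsPreWeylGraph where
  propertyW : W.PropertyW

/-- The setoid of homotopy. -/
def homotopySetoid (x y : W.Chamber) : Setoid (W.Gallery x y) :=
  Relation.EqvGen.setoid W.Contraction

variable {W}

theorem Homotopic.refl {x y : W.Chamber} (β : W.Gallery x y) : W.Homotopic β β :=
  Relation.EqvGen.refl _

theorem Homotopic.symm {x y : W.Chamber} {β γ : W.Gallery x y} (h : W.Homotopic β γ) :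
    W.Homotopic γ β := Relation.EqvGen.symm _ _ h

theorem Homotopic.trans {x y : W.Chamber} {β γ δ : W.Gallery x y} (h : W.Homotopic β γ)
    (h' : W.Homotopic γ δ) : W.Homotopic β δ := Relation.EqvGen.trans _ _ _ h h'

theorem Homotopic.of_move {x y : W.Chamber} {β γ : W.Gallery x y} (h : W.Move β γ) :
    W.Homotopic β γ := by
  have := Contraction.mk Quiver.Path.nil β γ Quiver.Path.nil h
  simp only [Quiver.Path.nil_comp, Quiver.Path.comp_nil] at this
  exact Relation.EqvGen.rel _ _ this

/-- A homotopy can be applied to a subgallery. -/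
theorem Homotopic.whisker {a x y b : W.Chamber} {β γ : W.Gallery x y} (h : W.Homotopic β γ)
    (p : W.Gallery a x) (q : W.Gallery y b) :
    W.Homotopic (Quiver.Path.comp p (Quiver.Path.comp β q))
      (Quiver.Path.comp p (Quiver.Path.comp γ q)) := by
  induction h with
  | rel β γ h =>
    obtain ⟨p', c, d, q', h⟩ := h
    have := Contraction.mk (p.comp p') c d (q'.comp q) h
    simp only [Quiver.Path.comp_assoc] at this ⊢
    exact Relation.EqvGen.rel _ _ this
  | refl β => exact Homotopic.refl _
  | symm β γ _ ih => exact ih.symm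
  | trans β γ δ _ _ ih ih' => exact ih.trans ih'

theorem Homotopic.comp {x y z : W.Chamber} {β γ : W.Gallery x y} {β' γ' : W.Gallery y z}
    (h : W.Homotopic β γ) (h' : W.Homotopic β' γ') :
    W.Homotopic (Quiver.Path.comp β β') (Quiver.Path.comp γ γ') := by
  have h₁ := h.whisker Quiver.Path.nil β'
  have h₂ := h'.whisker γ Quiver.Path.nil
  simp only [Quiver.Path.nil_comp, Quiver.Path.comp_nil] at h₁ h₂
  exact h₁.trans h₂

/-- A gallery followed by its inverse is null-homotopic. -/
theorem comp_reverse {x y : W.Chamber} (β : W.Gallery x y) :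
    W.Homotopic (Quiver.Path.comp β (Quiver.Path.reverse β)) Quiver.Path.nil := by
  induction β with
  | nil => exact Homotopic.refl _
  | cons p e ih =>
    refine Homotopic.trans ?_ ih
    have h := (Homotopic.of_move (Move.backtrack e.hom e.nontrivial)).whisker p
      (Quiver.Path.reverse p)
    simp only [Quiver.Path.nil_comp] at h
    have hE : Quiver.Path.comp (Quiver.Path.cons p e)
        (Quiver.Path.reverse (Quiver.Path.cons p e)) =
      Quiver.Path.comp p (Quiver.Path.comp (Quiver.Path.comp (W.single e.hom e.nontrivial)
        (W.single (W.panelInv e.hom) (W.not_isTrivial_panelInv e.nontrivial)))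
        (Quiver.Path.reverse p)) := by
      rw [← Quiver.Path.comp_assoc, ← Quiver.Path.comp_assoc]
      change Quiver.Path.comp _ (Quiver.Path.comp _ _) = _
      rw [← Quiver.Path.comp_assoc]
      rfl
    rw [hE]
    exact h

theorem reverse_reverse {x y : W.Chamber} (β : W.Gallery x y) :
    Quiver.Path.reverse (Quiver.Path.reverse β) = β := by
  induction β with
  | nil => rfl
  | cons p e ih =>
    change Quiver.Path.reverse (Quiver.Path.comp _ _) = _
    rw [Quiver.Path.reverse_comp, ih, Quiver.Path.reverse_toPath]
    have : Quiver.reverse (Quiver.reverse e) = e := by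
      obtain ⟨s, g, hg⟩ := e
      change Edge.mk s (W.panelInv (W.panelInv g)) _ = Edge.mk s g hg
      congr 1
      exact W.panelInv_panelInv g
    rw [this]
    rfl

theorem reverse_comp_self {x y : W.Chamber} (β : W.Gallery x y) :
    W.Homotopic (Quiver.Path.comp (Quiver.Path.reverse β) β) Quiver.Path.nil := by
  have := comp_reverse (W := W) (Quiver.Path.reverse β)
  rwa [reverse_reverse] at this

theorem Homotopic.reverse {x y : W.Chamber} {β γ : W.Gallery x y} (h : W.Homotopic β γ) :
    W.Homotopic (Quiver.Path.reverse β) (Quiver.Path.reverse γ) := by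
  have h₁ := (reverse_comp_self (W := W) β).comp (Homotopic.refl (Quiver.Path.reverse γ))
  have h₂ := (Homotopic.refl (Quiver.Path.reverse β)).comp (comp_reverse (W := W) γ)
  have h₃ := ((Homotopic.refl (Quiver.Path.reverse β)).comp h).comp
    (Homotopic.refl (Quiver.Path.reverse γ))
  simp only [Quiver.Path.nil_comp, Quiver.Path.comp_nil, Quiver.Path.comp_assoc] at h₁ h₂ h₃
  exact (h₂.symm.trans (h₃.symm.trans h₁))

variable (W)

/-- The set of vertices of the fundamental groupoid: the chambers. -/
def FundamentalGroupoid : Type u := W.Chamber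

/-- The fundamental groupoid: its edges are the homotopy classes of galleries. -/
instance fundamentalGroupoid : Groupoid W.FundamentalGroupoid where
  Hom x y := Quotient (W.homotopySetoid x y)
  id x := Quotient.mk (W.homotopySetoid x x) (Quiver.Path.nil (V := W.Chamber))
  comp {x y z} a b := Quotient.map₂ (sa := W.homotopySetoid x y) (sb := W.homotopySetoid y z)
    (sc := W.homotopySetoid x z) (fun β γ => Quiver.Path.comp β γ)
    (fun _ _ h _ _ h' => Homotopic.comp h h') a b
  inv {x y} a := Quotient.map (sa := W.homotopySetoid x y) (sb := W.homotopySetoid y x)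
    (fun β => Quiver.Path.reverse β) (fun _ _ h => Homotopic.reverse h) a
  id_comp a := by
    induction a using Quotient.inductionOn with
    | h β => exact congrArg (Quotient.mk _) (Quiver.Path.nil_comp β)
  comp_id a := by
    induction a using Quotient.inductionOn with
    | h β => rfl
  assoc a b c := by
    induction a using Quotient.inductionOn with
    | h β => induction b using Quotient.inductionOn with
      | h γ => induction c using Quotient.inductionOn with
        | h δ => exact congrArg (Quotient.mk _) (Quiver.Path.comp_assoc β γ δ)
  inv_comp a := by
    induction a using Quotient.inductionOn with
    | h β => exact Quotient.sound (reverse_comp_self β)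
  comp_inv a := by
    induction a using Quotient.inductionOn with
    | h β => exact Quotient.sound (comp_reverse β)

end

/-! ### Morphisms and induced homomorphisms of fundamental groupoids -/

/-- A morphism of Weyl data over a map of labels: a morphism of generalized chamber systems which
maps defining suites to null-homotopic galleries. -/
structure Morphism {S' : Type*} {S : Type*} (f : S' → S) {N : CoxeterMatrix S'}
    {M : CoxeterMatrix S} (V : WeylData.{u₁, v₁} N) (W : WeylData.{u, v} M) extends
    GeneralizedChamberSystem.Morphism f V.toGeneralizedChamberSystem
      W.toGeneralizedChamberSystem where
  suite : ∀ (s t : S') (x : V.Chamber) (θ : V.Gallery x x), θ ∈ V.defSuite s t x →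
    W.NullHomotopic (toMorphism.gallery θ)

namespace Morphism

variable {S' : Type*} {S : Type*} {f : S' → S} {N : CoxeterMatrix S'} {M : CoxeterMatrix S}
  {V : WeylData.{u₁, v₁} N} {W : WeylData.{u, v} M}

theorem single_congr {s : S} {x y : W.Chamber} {g h : W.PanelHom s x y} (e : g = h)
    (hg : ¬ W.IsTrivial g) (hh : ¬ W.IsTrivial h) : W.single g hg = W.single h hh := by
  subst e; rfl

theorem move (ω : Morphism f V W) {x y : V.Chamber} {β γ : V.Gallery x y} (h : V.Move β γ) :
    W.Homotopic (ω.gallery β) (ω.gallery γ) := by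
  induction h with
  | backtrack g hg =>
    have h := Homotopic.of_move (Move.backtrack (W := W) (ω.hom g) (ω.nontrivial g hg))
    rw [ω.gallery_comp]
    have e : ω.gallery (V.single (V.panelInv g) (V.not_isTrivial_panelInv hg)) =
      W.single (W.panelInv (ω.hom g)) (W.not_isTrivial_panelInv (ω.nontrivial g hg)) :=
      single_congr (ω.hom_inv g) (ω.nontrivial _ (V.not_isTrivial_panelInv hg)) _
    rw [e]
    exact h
  | shortcut g k hg hk hgk =>
    have hn : ¬ W.IsTrivial (W.panelComp (ω.hom g) (ω.hom k)) := by
      rw [← ω.hom_comp]; exact ω.nontrivial _ hgk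
    have h := Homotopic.of_move (Move.shortcut (W := W) (ω.hom g) (ω.hom k) (ω.nontrivial g hg)
      (ω.nontrivial k hk) hn)
    rw [ω.gallery_comp]
    have e : ω.gallery (V.single (V.panelComp g k) hgk) =
      W.single (W.panelComp (ω.hom g) (ω.hom k)) hn :=
      single_congr (ω.hom_comp g k) (ω.nontrivial _ hgk) _
    rw [e]
    exact h
  | suite θ hθ => exact ω.suite _ _ _ θ hθ

theorem homotopic (ω : Morphism f V W) {x y : V.Chamber} {β γ : V.Gallery x y}
    (h : V.Homotopic β γ) : W.Homotopic (ω.gallery β) (ω.gallery γ) := by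
  induction h with
  | rel β γ h =>
    obtain ⟨p, c, d, q, h⟩ := h
    rw [ω.gallery_comp, ω.gallery_comp, ω.gallery_comp, ω.gallery_comp]
    exact (ω.move h).whisker _ _
  | refl β => exact Homotopic.refl _
  | symm β γ _ ih => exact ih.symm
  | trans β γ δ _ _ ih ih' => exact ih.trans ih'

/-- The homomorphism of fundamental groupoids `[β] ↦ [ω ∘ β]` induced by a morphism `ω`. -/
def induced (ω : Morphism f V W) : V.FundamentalGroupoid ⥤ W.FundamentalGroupoid where
  obj x := ω.chamber x
  map {x y} a := Quotient.map (sa := V.homotopySetoid x y)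
    (sb := W.homotopySetoid (ω.chamber x) (ω.chamber y)) (fun β => ω.gallery β)
    (fun _ _ h => ω.homotopic h) a
  map_id _ := rfl
  map_comp a b := by
    induction a using Quotient.inductionOn with
    | h β => induction b using Quotient.inductionOn with
      | h γ => exact congrArg (Quotient.mk _) (ω.gallery_comp β γ)

end Morphism

/-! ### Restrictions and residues -/

section
variable {S : Type u₃} {M : CoxeterMatrix S} (W : WeylData.{u, v} M)

/-- The `J`-restriction: its defining suites are the defining `(s,t)`-suites of `W` with
`s, t ∈ J`. -/
def restrict (J : Set S) : WeylData.{u, v} (M.restrict J) where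
  toGeneralizedChamberSystem := W.toGeneralizedChamberSystem.restrict J
  defSuite s t x :=
    {θ | (W.toGeneralizedChamberSystem.restrictInclusion J).gallery θ ∈ W.defSuite s t x}
  defSuite_spec := by
    intro s t x θ hθ
    obtain ⟨h₁, h₂, h₃⟩ := W.defSuite_spec _ _ _ _ hθ
    refine ⟨fun h => h₁ (congrArg _ h), h₂, ?_⟩
    apply List.map_injective_iff.mpr (Subtype.val_injective (p := (· ∈ J)))
    rw [altWord_map]
    exact ((W.toGeneralizedChamberSystem.restrictInclusion J).types_gallery θ).symm.trans h₃

/-- The internal embedding of the `J`-restriction. -/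
def internal (J : Set S) : Morphism (Subtype.val : J → S) (W.restrict J) W where
  toMorphism := W.toGeneralizedChamberSystem.restrictInclusion J
  suite _ _ _ _ hθ := Homotopic.of_move (Move.suite _ hθ)

/-- The Weyl data with the same generalized chamber system as `W` which has all the suites of `W`
as defining suites. -/
def saturation : WeylData.{u, v} M where
  toGeneralizedChamberSystem := W.toGeneralizedChamberSystem
  defSuite s t x := {θ | W.IsSuite s t θ}
  defSuite_spec := fun _ _ _ _ hθ => ⟨hθ.1, hθ.2.1, hθ.2.2.1⟩

/-- The internal embedding of the `J`-restriction of `W.saturation`, which is the `J`-restriction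
of `W` whose defining suites are all the `(s,t)`-suites of `W` with `s, t ∈ J`. -/
def saturatedInternal (J : Set S) :
    Morphism (Subtype.val : J → S) (W.saturation.restrict J) W where
  toMorphism := W.toGeneralizedChamberSystem.restrictInclusion J
  suite _ _ _ _ hθ := hθ.2.2.2

/-- The full subdata on a set of chambers. -/
def full (X : Set W.Chamber) : WeylData.{u, v} M where
  toGeneralizedChamberSystem := W.toGeneralizedChamberSystem.full X
  defSuite s t x :=
    {θ | (W.toGeneralizedChamberSystem.fullInclusion X).gallery θ ∈ W.defSuite s t x.1}
  defSuite_spec := by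
    intro s t x θ hθ
    obtain ⟨h₁, h₂, h₃⟩ := W.defSuite_spec _ _ _ _ hθ
    refine ⟨h₁, h₂, ?_⟩
    have h := (W.toGeneralizedChamberSystem.fullInclusion X).types_gallery θ
    rw [List.map_id] at h
    exact h.symm.trans h₃

/-- The connected component of the chamber `C`. -/
def component (C : W.Chamber) : WeylData.{u, v} M :=
  W.full {D | Nonempty (W.Gallery C D)}

/-- The gallery of `W` given by a gallery of the `J`-residue at `C`, which is the connected
component of `C` in the `J`-restriction. -/
def ofResidue (J : Set S) (C : (W.restrict J).Chamber)
    {x y : ((W.restrict J).component C).Chamber}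
    (β : ((W.restrict J).component C).Gallery x y) : W.Gallery x.1 y.1 :=
  (W.toGeneralizedChamberSystem.restrictInclusion J).gallery
    (((W.restrict J).toGeneralizedChamberSystem.fullInclusion _).gallery β)

end

end WeylData

/-- A homomorphism of groupoids is an embedding if it is injective on the set of all edges. -/
def IsGroupoidEmbedding {G : Type*} {H : Type*} [Groupoid G] [Groupoid H] (F : G ⥤ H) : Prop :=
  Function.Injective (fun e : (Σ x : G, Σ y : G, (x ⟶ y)) =>
    (⟨F.obj e.1, F.obj e.2.1, F.map e.2.2⟩ : Σ x : H, Σ y : H, (x ⟶ y)))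

/-! Everything rests on one claim: if Weyl data `V` over `J` satisfies (PW1) and maps to `W` with
(W), over the inclusion of `J` in `S`, then galleries of `V` whose images are homotopic in `W` are
already homotopic in `V` (`homotopic_of_homotopic_gallery`). It is enough to treat a closed gallery
`β` with null-homotopic image. By (PW1) every braid move on the type of a gallery is realized by a
homotopy in `V`. A non-reduced word is braid equivalent to one with a repeated letter, and two
consecutive edges of one type can be shortened. So `β` is homotopic in `V` to some `γ` of reduced
type (`exists_homotopic_isReduced`). In `W` the image of `γ` is a geodesic homotopic to the trivial
gallery; by (W) its `W`-length is 1, hence `γ` is empty.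

The saturated restriction always satisfies (PW1): a maximal geodesic of type in `J` and an opposite
one homotopic to it in `W` bound a suite of `W`, which is a defining suite there. Conversely, an
embedding reflects homotopies, so (PW1) descends from `W` to the plain restriction. Homotopies never
leave a connected component, which gives the statements on residues.

Reducedness is always measured in the Coxeter group over `S`, so parabolic subgroups are not needed.
The word combinatorics is Matsumoto's theorem, deduced from the exchange condition and from the fact
that `m_{st}` is the exact order of `s t`. -/

/-! ### The geometric representation and the exact order of a product of two simple reflections -/

namespace CoxeterMatrix

variable {B : Type*} (M : CoxeterMatrix B)

/-- The coroot of index `i` of the geometric representation: the linear form with the value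
`-2 cos (π / m_{ij})` at the basis vector of index `j`. (As `π / 0 = 0`, it is `-2` if
`m_{ij} = ∞`.) -/
noncomputable def geomCoroot (i : B) : Module.Dual ℝ (B →₀ ℝ) :=
  Finsupp.linearCombination ℝ (fun j => -2 * Real.cos (Real.pi / M i j))

theorem geomCoroot_single (i j : B) :
    M.geomCoroot i (Finsupp.single j 1) = -2 * Real.cos (Real.pi / M i j) := by
  simp [geomCoroot]

theorem geomCoroot_self (i : B) : M.geomCoroot i (Finsupp.single i 1) = 2 := by
  simp [geomCoroot_single]

/-- The reflection of index `i` of the geometric representation. -/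
noncomputable def geomReflection (i : B) : (B →₀ ℝ) ≃ₗ[ℝ] (B →₀ ℝ) :=
  Module.reflection (M.geomCoroot_self i)

/-- The powers of a product of two reflections are given by Chebyshev polynomials `S` at this
number. With `θ = π / m_{ij}` it is `2 cos 2θ`, where `S_n` times `sin 2θ` equals `sin (2(n+1)θ)`.
-/
theorem geomCoroot_mul_geomCoroot (i j : B) :
    M.geomCoroot i (Finsupp.single j 1) * M.geomCoroot j (Finsupp.single i 1) - 2 =
      2 * Real.cos (2 * (Real.pi / M i j)) := by
  rw [geomCoroot_single, geomCoroot_single, M.symmetric j i, Real.cos_two_mul]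
  ring

theorem two_le_of_ne {i j : B} (hij : i ≠ j) (h : M i j ≠ 0) : 2 ≤ M i j := by
  have := M.off_diagonal i j hij
  omega

theorem sin_two_mul_pi_div_ne_zero {i j : B} (h : 3 ≤ M i j) :
    Real.sin (2 * (Real.pi / M i j)) ≠ 0 := by
  have h3 : (3 : ℝ) ≤ M i j := by exact_mod_cast h
  apply ne_of_gt
  apply Real.sin_pos_of_pos_of_lt_pi
  · positivity
  · rw [← mul_div_assoc, div_lt_iff₀ (by linarith)]
    nlinarith [Real.pi_pos]

open Polynomial.Chebyshev in
-- Every correction term in the formula for the `m`-th power has a vanishing factor when `m ≥ 3`.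
-- For `m = 2p` it is `S_{p-1}`, proportional to `sin π`; for `m = 2p + 1` it is `S_p + S_{p-1}`,
-- proportional to `sin (π + θ) + sin (π - θ)`.
theorem geomReflection_isLiftable : M.IsLiftable M.geomReflection := by
  intro i j
  by_cases hij : i = j
  · subst hij
    rw [M.diagonal, pow_one]
    ext1 z
    exact Module.involutive_reflection (M.geomCoroot_self i) z
  by_cases h0 : M i j = 0
  · rw [h0, pow_zero]
  ext1 z
  have hpow := Module.reflection_mul_reflection_pow_apply (M.geomCoroot_self i)
    (M.geomCoroot_self j) (M i j) z _ (M.geomCoroot_mul_geomCoroot i j).symm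
  refine hpow.trans ?_
  rcases (M.two_le_of_ne hij h0).eq_or_lt with h2 | h3
  -- For `m = 2` one cannot divide by `sin 2θ = 0`, but the two pairings vanish and the formula is
  -- evaluated directly.
  · have hc : Real.cos (Real.pi / (2 : ℕ)) = 0 := by simp
    have hπ : 2 * (Real.pi / (2 : ℕ)) = Real.pi := by push_cast; ring
    rw [M.geomCoroot_single, M.geomCoroot_single, M.symmetric j i, ← h2, hc, hπ, Real.cos_pi]
    norm_num [S_neg_one]
    module
  · set θ := Real.pi / M i j with hθ
    have hs := M.sin_two_mul_pi_div_ne_zero h3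
    rw [← hθ] at hs
    have hm : (M i j : ℝ) * θ = Real.pi := by
      rw [hθ]; field_simp
    have hS := S_two_mul_real_cos (2 * θ)
    rcases Nat.even_or_odd' (M i j) with ⟨p, hp | hp⟩
    · have hz : (S ℝ ((p : ℤ) - 1)).eval (2 * Real.cos (2 * θ)) = 0 := by
        have := hS ((p : ℤ) - 1)
        have e : (((p : ℤ) - 1 : ℤ) + 1 : ℝ) * (2 * θ) = Real.pi := by
          rw [← hm, hp]; push_cast; ring
        rw [e, Real.sin_pi] at this
        exact (mul_eq_zero.mp this).resolve_right hs
      have e₁ : ((M i j : ℤ) - 2) / 2 = p - 1 := by omega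
      have e₂ : ((M i j : ℤ) - 1) / 2 = p - 1 := by omega
      rw [e₁, e₂, hz]
      simp
    · have hz : (S ℝ (p : ℤ)).eval (2 * Real.cos (2 * θ)) +
          (S ℝ ((p : ℤ) - 1)).eval (2 * Real.cos (2 * θ)) = 0 := by
        have h₁ := hS ((p : ℤ) - 1)
        have h₂ := hS (p : ℤ)
        have e₁ : (((p : ℤ) - 1 : ℤ) + 1 : ℝ) * (2 * θ) = Real.pi - θ := by
          rw [← hm, hp]; push_cast; ring
        have e₂ : (((p : ℤ) : ℝ) + 1) * (2 * θ) = θ + Real.pi := by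
          rw [← hm, hp]; push_cast; ring
        rw [e₁, Real.sin_pi_sub] at h₁
        rw [e₂, Real.sin_add_pi] at h₂
        refine (mul_eq_zero.mp (?_ : _ * Real.sin (2 * θ) = 0)).resolve_right hs
        rw [add_mul, h₁, h₂]; ring
      have e₁ : ((M i j : ℤ) - 1) / 2 = p := by omega
      have e₂ : ((M i j : ℤ) - 3) / 2 = p - 1 := by omega
      have e₃ : (M i j : ℤ) / 2 = p := by omega
      have e₄ : ((M i j : ℤ) - 2) / 2 = p - 1 := by omega
      rw [e₁, e₂, e₃, e₄, hz]
      simp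

open Polynomial.Chebyshev in
-- The `k`-th power is tested on the basis vector of index `i`. Were it fixed, its coordinates would
-- give `S_k + S_{k-1} = 1` and, if `m ≠ 2`, `S_{k-1} = 0`. For `m = ∞` the argument is 2 and
-- `S_{k-1}` is `k`. For finite `m ≥ 3` the two equations give `cos 2kθ = 1`, although `0 < 2kθ <
-- 2π`.
theorem geomReflection_mul_pow_ne_one {i j : B} (hij : i ≠ j) {k : ℕ} (hk : 0 < k)
    (hkM : M i j = 0 ∨ k < M i j) : (M.geomReflection i * M.geomReflection j) ^ k ≠ 1 := by
  classical
  intro h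
  have hpow := Module.reflection_mul_reflection_pow_apply_self (M.geomCoroot_self i)
    (M.geomCoroot_self j) k _ (M.geomCoroot_mul_geomCoroot i j).symm
  have h' : Finsupp.single i (1 : ℝ) = _ := (congrArg (· (Finsupp.single i (1 : ℝ))) h).symm.trans hpow
  have hi := DFunLike.congr_fun h' i
  have hj := DFunLike.congr_fun h' j
  simp only [Finsupp.add_apply, Finsupp.smul_apply, Finsupp.single_apply, hij, hij.symm, if_true,
    if_false, smul_eq_mul, mul_zero, mul_one, add_zero, zero_add] at hi hj
  have hji : M.geomCoroot j (Finsupp.single i 1) = -2 * Real.cos (Real.pi / M i j) := by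
    rw [M.geomCoroot_single, M.symmetric j i]
  rw [hji] at hj
  rcases hkM with h0 | hkM
  · rw [h0] at hj
    simp only [Nat.cast_zero, div_zero, mul_zero, Real.cos_zero, mul_one] at hj
    rw [S_eval_two] at hj
    push_cast at hj
    have : (0 : ℝ) < k := by exact_mod_cast hk
    linarith
  · rcases (M.two_le_of_ne hij (by omega)).eq_or_lt with h2 | h3
    · have hk1 : k = 1 := by omega
      rw [hk1, ← h2] at hi
      have : 2 * (Real.pi / (2 : ℕ)) = Real.pi := by push_cast; ring
      rw [this] at hi
      norm_num at hi
    · have hs := M.sin_two_mul_pi_div_ne_zero h3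
      have hM : (3 : ℝ) ≤ M i j := by exact_mod_cast h3
      set θ := Real.pi / M i j with hθ
      have hm : (M i j : ℝ) * θ = Real.pi := by rw [hθ]; field_simp
      have hc : Real.cos θ ≠ 0 := by
        intro hc; rw [Real.sin_two_mul, hc] at hs; simp at hs
      have hS := S_two_mul_real_cos (2 * θ)
      have hz : (S ℝ ((k : ℤ) - 1)).eval (2 * Real.cos (2 * θ)) = 0 := by
        have hc' : -(-2 * Real.cos θ) ≠ 0 := by simpa using hc
        exact (mul_eq_zero.mp hj.symm).resolve_right hc'
      have h₁ := hS ((k : ℤ) - 1)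
      have h₂ := hS (k : ℤ)
      rw [hz, add_zero] at hi
      have e₁ : (((k : ℤ) - 1 : ℤ) + 1 : ℝ) * (2 * θ) = 2 * k * θ := by push_cast; ring
      have e₂ : (((k : ℤ) : ℝ) + 1) * (2 * θ) = 2 * k * θ + 2 * θ := by push_cast; ring
      rw [hz, zero_mul, e₁] at h₁
      rw [← hi, one_mul, e₂, Real.sin_add, ← h₁, zero_mul, zero_add] at h₂
      have hc1 : Real.cos (2 * k * θ) = 1 := by
        have := mul_right_cancel₀ hs ((one_mul _).trans h₂)
        exact this.symm
      have hθp : 0 < θ := by positivity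
      have hkp : (0 : ℝ) < k := by exact_mod_cast hk
      have hkm : (k : ℝ) < M i j := by exact_mod_cast hkM
      have := (Real.cos_eq_one_iff_of_lt_of_lt (x := 2 * k * θ)
        (by nlinarith [Real.pi_pos, mul_pos hkp hθp]) (by rw [← hm]; nlinarith)).mp hc1
      nlinarith [mul_pos hkp hθp]

end CoxeterMatrix

/-! ### The exchange condition, from an action on signed group elements -/

namespace CoxeterSystem

variable {B : Type*} {M : CoxeterMatrix B} {G : Type*} [Group G] (cs : CoxeterSystem M G)

theorem simple_mul_simple_pow_ne_one {i j : B} (hij : i ≠ j) {k : ℕ} (hk : 0 < k)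
    (hkM : M i j = 0 ∨ k < M i j) : (cs.simple i * cs.simple j) ^ k ≠ 1 := by
  intro h
  apply M.geomReflection_mul_pow_ne_one hij hk hkM
  have := congrArg (cs.lift ⟨_, M.geomReflection_isLiftable⟩) h
  simpa using this

open Classical in
/-- The permutation of `G × ZMod 2` which conjugates the first component by a simple reflection,
and changes the sign over this reflection. -/
noncomputable def signPerm (i : B) : Equiv.Perm (G × ZMod 2) where
  toFun p := (cs.simple i * p.1 * cs.simple i, p.2 + if p.1 = cs.simple i then 1 else 0)
  invFun p := (cs.simple i * p.1 * cs.simple i, p.2 + if p.1 = cs.simple i then 1 else 0)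
  left_inv p := by
    have h : cs.simple i * p.1 * cs.simple i = cs.simple i ↔ p.1 = cs.simple i := by
      constructor
      · intro h
        have := congrArg (fun g => cs.simple i * g * cs.simple i) h
        simpa [mul_assoc] using this
      · intro h; simp [h]
    ext
    · simp [mul_assoc]
    · simp only [h]
      split_ifs
      · rw [add_assoc, show (1 + 1 : ZMod 2) = 0 from rfl, add_zero]
      · simp
  right_inv p := by
    have h : cs.simple i * p.1 * cs.simple i = cs.simple i ↔ p.1 = cs.simple i := by
      constructor
      · intro h
        have := congrArg (fun g => cs.simple i * g * cs.simple i) h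
        simpa [mul_assoc] using this
      · intro h; simp [h]
    ext
    · simp [mul_assoc]
    · simp only [h]
      split_ifs
      · rw [add_assoc, show (1 + 1 : ZMod 2) = 0 from rfl, add_zero]
      · simp

open Classical in
theorem signPerm_apply (i : B) (p : G × ZMod 2) : cs.signPerm i p =
    (cs.simple i * p.1 * cs.simple i, p.2 + if p.1 = cs.simple i then 1 else 0) := rfl

theorem simple_mul_pow_mul_simple (i j : B) (l : ℕ) :
    cs.simple j * (cs.simple i * cs.simple j) ^ l = (cs.simple j * cs.simple i) ^ l * cs.simple j := by
  induction l with
  | zero => simp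
  | succ l ih => rw [pow_succ, ← mul_assoc, ih, pow_succ]; simp only [mul_assoc]

theorem pow_mul_inv (i j : B) (l : ℕ) :
    (cs.simple i * cs.simple j) ^ l * (cs.simple j * cs.simple i) ^ l = 1 := by
  have : (cs.simple j * cs.simple i) = (cs.simple i * cs.simple j)⁻¹ := by simp
  rw [this, inv_pow, mul_inv_cancel]

open Classical in
-- An explicit record of the sign changes is needed for the braid relation. The factor added at
-- stage `k` flips the sign over the terms of index `2k` and `2k + 1`, which is what `key1` and
-- `key2` identify.
theorem signPerm_mul_pow_apply (i j : B) (k : ℕ) (p : G × ZMod 2) :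
    ((cs.signPerm i * cs.signPerm j) ^ k) p =
      ((cs.simple i * cs.simple j) ^ k * p.1 * (cs.simple j * cs.simple i) ^ k,
        p.2 + ∑ l ∈ Finset.range (2 * k),
          if p.1 = (cs.simple j * cs.simple i) ^ l * cs.simple j then 1 else 0) := by
  induction k with
  | zero => simp
  | succ k ih =>
    rw [pow_succ', Equiv.Perm.mul_apply, ih, Equiv.Perm.mul_apply, signPerm_apply, signPerm_apply]
    have key (q g : G) : (cs.simple i * cs.simple j) ^ k * q * (cs.simple j * cs.simple i) ^ k = g ↔
        q = (cs.simple j * cs.simple i) ^ k * g * (cs.simple i * cs.simple j) ^ k := by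
      constructor
      · rintro rfl
        simp only [← mul_assoc]
        rw [cs.pow_mul_inv j i, one_mul, mul_assoc, cs.pow_mul_inv j i, mul_one]
      · rintro rfl
        simp only [← mul_assoc]
        rw [cs.pow_mul_inv i j, one_mul, mul_assoc, cs.pow_mul_inv i j, mul_one]
    have key2 : cs.simple j * ((cs.simple i * cs.simple j) ^ k * p.1 *
        (cs.simple j * cs.simple i) ^ k) * cs.simple j = cs.simple i ↔
        p.1 = (cs.simple j * cs.simple i) ^ (2 * k + 1) * cs.simple j := by
      have : cs.simple j * ((cs.simple i * cs.simple j) ^ k * p.1 *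
        (cs.simple j * cs.simple i) ^ k) * cs.simple j = cs.simple i ↔
        (cs.simple i * cs.simple j) ^ k * p.1 * (cs.simple j * cs.simple i) ^ k =
          cs.simple j * cs.simple i * cs.simple j := by
        generalize (cs.simple i * cs.simple j) ^ k * p.1 * (cs.simple j * cs.simple i) ^ k = q
        constructor
        · rintro h
          rw [← h]; simp [mul_assoc]
        · rintro rfl
          simp [mul_assoc]
      rw [this, key, mul_assoc, mul_assoc (cs.simple j * cs.simple i), simple_mul_pow_mul_simple,
        show 2 * k + 1 = k + 1 + k by ring, pow_add, pow_succ]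
      simp only [mul_assoc]
    have key1 : (cs.simple i * cs.simple j) ^ k * p.1 *
        (cs.simple j * cs.simple i) ^ k = cs.simple j ↔
        p.1 = (cs.simple j * cs.simple i) ^ (2 * k) * cs.simple j := by
      rw [key, mul_assoc, simple_mul_pow_mul_simple, ← mul_assoc, ← pow_add, two_mul]
    ext
    · simp only [pow_succ' (cs.simple i * cs.simple j), pow_succ (cs.simple j * cs.simple i),
        mul_assoc]
    · simp only [key1, key2]
      rw [show 2 * (k + 1) = 2 * k + 1 + 1 by ring, Finset.sum_range_succ, Finset.sum_range_succ]
      simp only [add_assoc]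

/-- Since the `m`-th power of `s_j s_i` is 1, the terms of index `l` and `l + m` agree, and the sign
change is an even number. -/
theorem signPerm_isLiftable : M.IsLiftable cs.signPerm := by
  classical
  intro i j
  ext1 p
  have h₂ : (cs.simple j * cs.simple i) ^ M i j = 1 := cs.simple_mul_simple_pow' i j
  rw [signPerm_mul_pow_apply, cs.simple_mul_simple_pow, h₂, two_mul, Finset.sum_range_add]
  simp only [pow_add, h₂, one_mul]
  rw [← two_mul, show (2 : ZMod 2) = 0 from rfl, zero_mul]
  simp

open Classical in
-- The left side depends only on the group element, so the parity of the number of occurrences of an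
-- element in the right inversion sequence does not depend on the word.
theorem lift_signPerm_wordProd (ω : List B) (p : G × ZMod 2) :
    cs.lift ⟨_, cs.signPerm_isLiftable⟩ (cs.wordProd ω) p =
      (cs.wordProd ω * p.1 * (cs.wordProd ω)⁻¹, p.2 + ((cs.rightInvSeq ω).count p.1 : ℕ)) := by
  induction ω with
  | nil => simp
  | cons i ω ih =>
    rw [wordProd_cons, map_mul, lift_apply_simple, Equiv.Perm.mul_apply, ih, signPerm_apply]
    have : cs.wordProd ω * p.1 * (cs.wordProd ω)⁻¹ = cs.simple i ↔
        (cs.wordProd ω)⁻¹ * cs.simple i * cs.wordProd ω = p.1 := by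
      constructor
      · intro h; rw [← h]; group
      · intro h; rw [← h]; group
    ext
    · simp [mul_assoc]
    · simp only [this, rightInvSeq, List.count_cons, beq_iff_eq]
      push_cast
      rw [add_assoc]

/-- A right descent allows a reduced word for the same element which ends in `i`. There the
reflection occurs exactly once, so by parity it occurs in the sequence of `ω` too. -/
theorem mem_rightInvSeq_of_isRightDescent {ω : List B} {i : B}
    (h : cs.IsRightDescent (cs.wordProd ω) i) : cs.simple i ∈ cs.rightInvSeq ω := by
  classical
  obtain ⟨ω', hω', hω'w⟩ := cs.exists_isReduced (cs.wordProd ω * cs.simple i)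
  have hw : cs.wordProd (ω' ++ [i]) = cs.wordProd ω := by
    rw [wordProd_append, ← hω'w]; simp
  have hred : cs.IsReduced (ω' ++ [i]) := by
    rw [isRightDescent_iff] at h
    rw [IsReduced, hw, ← h, hω'w, hω'.eq]; simp
  have hmem : cs.simple i ∈ cs.rightInvSeq (ω' ++ [i]) := by
    rw [← List.concat_eq_append, rightInvSeq_concat]; simp
  have hc := List.count_eq_one_of_mem hred.nodup_rightInvSeq hmem
  have e := cs.lift_signPerm_wordProd ω (cs.simple i, 0)
  rw [← hw, cs.lift_signPerm_wordProd, hc, hw] at e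
  have e₂ := congrArg Prod.snd e
  by_contra hn
  rw [List.count_eq_zero_of_not_mem hn] at e₂
  simp at e₂

/-- The exchange condition. -/
theorem exists_eraseIdx_of_isLeftDescent {ω : List B} {i : B}
    (h : cs.IsLeftDescent (cs.wordProd ω) i) :
    ∃ j, ∃ hj : j < ω.length, (cs.leftInvSeq ω)[j]'(by simpa using hj) = cs.simple i ∧
      cs.simple i * cs.wordProd ω = cs.wordProd (ω.eraseIdx j) := by
  have h' : cs.IsRightDescent (cs.wordProd ω.reverse) i := by
    rw [wordProd_reverse, isRightDescent_inv_iff]; exact h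
  have hmem := cs.mem_rightInvSeq_of_isRightDescent h'
  rw [rightInvSeq_reverse, List.mem_reverse] at hmem
  obtain ⟨j, hj, e⟩ := List.mem_iff_getElem.mp hmem
  refine ⟨j, by simpa using hj, e, ?_⟩
  rw [← getD_leftInvSeq_mul_wordProd, List.getD_eq_getElem _ _ hj, e]

theorem getElem_leftInvSeq_altWord (s t : B) (k j : ℕ) (hj : j < (cs.leftInvSeq (altWord s t k)).length) :
    (cs.leftInvSeq (altWord s t k))[j] = (cs.simple s * cs.simple t) ^ j * cs.simple s := by
  induction k generalizing s t j with
  | zero => simp [altWord] at hj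
  | succ k ih =>
    cases j with
    | zero => simp [altWord, leftInvSeq]
    | succ j =>
      simp only [altWord, leftInvSeq, List.getElem_cons_succ, List.getElem_map]
      rw [ih, MulAut.conj_apply, inv_simple, ← mul_assoc, simple_mul_pow_mul_simple, pow_succ]
      simp only [mul_assoc]

end CoxeterSystem

/-! ### Braid moves and Matsumoto's theorem -/

theorem reverse_altWord {S : Type*} (s t : S) (m : ℕ) :
    (altWord s t m).reverse = CoxeterSystem.alternatingWord t s m := by
  induction m generalizing s t with
  | zero => rfl
  | succ m ih => simp [altWord, ih, CoxeterSystem.alternatingWord]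

theorem length_altWord {S : Type*} (s t : S) (m : ℕ) : (altWord s t m).length = m := by
  induction m generalizing s t with
  | zero => rfl
  | succ m ih => simp [altWord, ih]

namespace CoxeterMatrix

variable {B : Type*} (M : CoxeterMatrix B)

/-- A braid move replaces a subword `s t s ⋯` of length `m_{st} < ∞` by `t s t ⋯`. -/
inductive BraidMove : List B → List B → Prop
  | mk (a b : List B) {s t : B} (hst : s ≠ t) (h : M s t ≠ 0) :
      BraidMove (a ++ (altWord s t (M s t) ++ b)) (a ++ (altWord t s (M s t) ++ b))

/-- Two words are braid equivalent if they are related by a sequence of braid moves. -/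
def BraidEquiv : List B → List B → Prop := Relation.ReflTransGen M.BraidMove

variable {M}

theorem BraidMove.cons {ω ω' : List B} (h : M.BraidMove ω ω') (i : B) :
    M.BraidMove (i :: ω) (i :: ω') := by
  obtain ⟨a, b, hst, h⟩ := h
  exact BraidMove.mk (i :: a) b hst h

theorem BraidEquiv.cons {ω ω' : List B} (h : M.BraidEquiv ω ω') (i : B) :
    M.BraidEquiv (i :: ω) (i :: ω') :=
  Relation.ReflTransGen.lift (i :: ·) (fun _ _ h => h.cons i) _ _ h

end CoxeterMatrix

namespace CoxeterSystem

variable {B : Type*} {M : CoxeterMatrix B} {G : Type*} [Group G] (cs : CoxeterSystem M G)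

theorem wordProd_altWord_eq (s t : B) :
    cs.wordProd (altWord s t (M s t)) = cs.wordProd (altWord t s (M s t)) := by
  have h := cs.wordProd_braidWord_eq s t
  rw [braidWord, braidWord, M.symmetric t s, ← reverse_altWord, ← reverse_altWord,
    wordProd_reverse, wordProd_reverse] at h
  exact (inv_injective h).symm

/-- The alternating prefix grows by one letter at a time. Exchanging for the new first letter `s`
deletes a letter of the old word. If it lay in the old prefix, at place `j < k`, then `(t s)^j t =
s`, so `(t s)^(j+1) = 1`, contrary to the order of `t s`. Hence the deletion takes place in `u`. -/
theorem exists_isReduced_altWord_append {w : G} {s t : B} (hst : s ≠ t)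
    (hs : cs.IsLeftDescent w s) (ht : cs.IsLeftDescent w t) (k : ℕ)
    (hk : M s t = 0 ∨ k ≤ M s t) :
    ∃ u, cs.wordProd (altWord s t k ++ u) = w ∧ cs.IsReduced (altWord s t k ++ u) := by
  induction k generalizing s t with
  | zero =>
    obtain ⟨u, hu, hw⟩ := cs.exists_isReduced w
    exact ⟨u, hw.symm, hu⟩
  | succ k ih =>
    obtain ⟨u, hw, hu⟩ := ih hst.symm ht hs (by rw [M.symmetric]; omega)
    subst hw
    obtain ⟨j, hj, hjs, hje⟩ := cs.exists_eraseIdx_of_isLeftDescent hs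
    rcases lt_or_ge j k with hjk | hjk
    · exfalso
      have hlis : (cs.leftInvSeq (altWord t s k)) = (cs.leftInvSeq (altWord t s k ++ u)).take k := by
        rw [← leftInvSeq_take]
        congr 1
        rw [List.take_append_of_le_length (by simp [length_altWord]),
          List.take_of_length_le (by simp [length_altWord])]
      have hj' : j < (cs.leftInvSeq (altWord t s k)).length := by simpa [length_altWord] using hjk
      have e := cs.getElem_leftInvSeq_altWord t s k j hj'
      have e' : (cs.leftInvSeq (altWord t s k))[j] = cs.simple s := by
        rw [← hjs]; simp only [hlis, List.getElem_take]
      rw [e'] at e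
      apply cs.simple_mul_simple_pow_ne_one hst.symm (Nat.succ_pos j)
        (by rw [M.symmetric]; omega)
      rw [pow_succ, ← mul_assoc, ← e, simple_mul_simple_self]
    · have he : (altWord t s k ++ u).eraseIdx j = altWord t s k ++ u.eraseIdx (j - k) := by
        rw [List.eraseIdx_append_of_length_le (by simpa [length_altWord] using hjk),
          length_altWord]
      refine ⟨u.eraseIdx (j - k), ?_, ?_⟩
      · rw [altWord, List.cons_append, wordProd_cons, ← he, ← hje]; simp
      · rw [List.length_append, length_altWord] at hj
        rw [IsReduced, altWord, List.cons_append, wordProd_cons, ← he, ← hje,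
          simple_mul_simple_cancel_left, hu.eq, he]
        simp only [List.length_append, length_altWord, List.length_cons, List.length_eraseIdx]
        rw [if_pos (by omega)]
        omega

/-- Otherwise a reduced word for `w` could have an alternating prefix longer than `w`. -/
theorem ne_zero_of_isLeftDescent {w : G} {s t : B} (hst : s ≠ t)
    (hs : cs.IsLeftDescent w s) (ht : cs.IsLeftDescent w t) : M s t ≠ 0 := by
  intro h
  obtain ⟨u, hw, hu⟩ := cs.exists_isReduced_altWord_append hst hs ht (cs.length w + 1) (Or.inl h)
  have := hu.eq
  rw [hw, List.length_append, length_altWord] at this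
  omega

theorem isLeftDescent_of_isReduced_cons {i : B} {ω : List B} (h : cs.IsReduced (i :: ω)) :
    cs.IsLeftDescent (cs.wordProd (i :: ω)) i := by
  have h' : cs.IsReduced ω := h.drop 1
  rw [IsLeftDescent, h.eq, wordProd_cons, simple_mul_simple_cancel_left, h'.eq]
  simp

/-- Matsumoto's theorem. -/
theorem braidEquiv_of_isReduced {ω ω' : List B} (hω : cs.IsReduced ω) (hω' : cs.IsReduced ω')
    (h : cs.wordProd ω = cs.wordProd ω') : M.BraidEquiv ω ω' := by
  induction hn : ω.length generalizing ω ω' with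
  | zero =>
    have hl : ω'.length = 0 := by rw [← hω'.eq, ← h, hω.eq, hn]
    rw [List.length_eq_zero_iff] at hn hl
    subst hn hl
    exact Relation.ReflTransGen.refl
  | succ n ih =>
    have hl : ω'.length = n + 1 := by rw [← hω'.eq, ← h, hω.eq, hn]
    have same {i : B} {a b : List B} (ha : cs.IsReduced (i :: a)) (hb : cs.IsReduced (i :: b))
        (hab : cs.wordProd (i :: a) = cs.wordProd (i :: b)) (hal : (i :: a).length = n + 1) :
        M.BraidEquiv (i :: a) (i :: b) := by
      refine CoxeterMatrix.BraidEquiv.cons (ih (ha.drop 1) (hb.drop 1) ?_ (by simpa using hal)) i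
      rw [wordProd_cons, wordProd_cons] at hab
      exact mul_left_cancel hab
    obtain ⟨s, a, rfl⟩ := List.exists_cons_of_length_eq_add_one hn
    obtain ⟨t, b, rfl⟩ := List.exists_cons_of_length_eq_add_one hl
    by_cases hst : s = t
    · subst hst
      exact same hω hω' h hn
    have hs := cs.isLeftDescent_of_isReduced_cons hω
    have ht := cs.isLeftDescent_of_isReduced_cons hω'
    rw [← h] at ht
    have h0 := cs.ne_zero_of_isLeftDescent hst hs ht
    -- The two words have different first letters, both left descents. They are joined through two
    -- reduced words which differ by one braid move and begin with `s` and `t`; each outer step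
    -- compares words with a common first letter.
    obtain ⟨u, hu, hur⟩ := cs.exists_isReduced_altWord_append hst hs ht (M s t) (Or.inr le_rfl)
    -- Writing `m_{st}` as a successor exposes the first letters of the alternating words, so that
    -- `same` applies.
    obtain ⟨m, hm⟩ := Nat.exists_eq_succ_of_ne_zero h0
    have hmove := CoxeterMatrix.BraidMove.mk (M := M) [] u hst h0
    have hprod : cs.wordProd (altWord t s (M s t) ++ u) = cs.wordProd (t :: b) := by
      rw [wordProd_append, ← cs.wordProd_altWord_eq, ← wordProd_append, hu, h]
    have hlen : (altWord s t (M s t) ++ u).length = n + 1 := by rw [← hur.eq, hu, hω.eq, hn]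
    have hur' : cs.IsReduced (altWord t s (M s t) ++ u) := by
      rw [IsReduced, hprod, ← h, hω.eq, hn, ← hlen]; simp [length_altWord]
    have h₁ : M.BraidEquiv (s :: a) (altWord s t (M s t) ++ u) := by
      rw [hm] at hu hur ⊢
      exact same hω hur hu.symm hn
    have h₂ : M.BraidEquiv (altWord t s (M s t) ++ u) (t :: b) := by
      have hlen' : (altWord t s (M s t) ++ u).length = n + 1 := by
        rw [← hlen]; simp [length_altWord]
      rw [hm] at hprod hur' hlen' ⊢
      exact same hur' hω' hprod hlen'
    exact (h₁.tail hmove).trans h₂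

/-- A word which is not reduced is braid equivalent to a word with a repeated letter. -/
theorem exists_braidEquiv_of_not_isReduced {ω : List B} (h : ¬ cs.IsReduced ω) :
    ∃ (a b : List B) (s : B), M.BraidEquiv ω (a ++ (s :: s :: b)) := by
  induction ω with
  | nil => exact absurd (by simp [IsReduced]) h
  | cons i ω ih =>
    by_cases hω : cs.IsReduced ω
    · have hd : cs.IsLeftDescent (cs.wordProd ω) i := by
        by_contra hd
        rw [not_isLeftDescent_iff] at hd
        apply h
        rw [IsReduced, wordProd_cons, hd, hω.eq]; simp
      -- As `i` is a left descent, `i :: ω'` is another reduced word for the product of `ω`. By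
      -- Matsumoto's theorem `i :: ω` then becomes `i :: i :: ω'`.
      obtain ⟨ω', hω', hw⟩ := cs.exists_isReduced (cs.simple i * cs.wordProd ω)
      refine ⟨[], ω', i, (cs.braidEquiv_of_isReduced hω ?_ ?_).cons i⟩
      · rw [isLeftDescent_iff] at hd
        rw [IsReduced, wordProd_cons, ← hw, simple_mul_simple_cancel_left, ← hd, hw, hω'.eq]; simp
      · rw [wordProd_cons, ← hw, simple_mul_simple_cancel_left]
    · obtain ⟨a, b, s, hb⟩ := ih hω
      exact ⟨i :: a, b, s, hb.cons i⟩

end CoxeterSystem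

/-! ### Types of galleries; splitting and lifting galleries -/

theorem altWord_two_mul_append {S : Type*} (s t : S) (m : ℕ) :
    altWord s t (2 * m) ++ [s] = altWord s t (2 * m + 1) := by
  induction m with
  | zero => rfl
  | succ m ih =>
    rw [show 2 * (m + 1) = 2 * m + 1 + 1 by ring]
    simp only [altWord, List.cons_append] at ih ⊢
    rw [ih]

theorem altWord_append_reverse {S : Type*} (s t : S) (m : ℕ) :
    altWord s t m ++ (altWord t s m).reverse = altWord s t (2 * m) := by
  induction m generalizing s t with
  | zero => rfl
  | succ m ih =>
    rw [altWord, altWord, List.reverse_cons, List.cons_append, ← List.append_assoc, ih,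
      altWord_two_mul_append]
    rfl

theorem CoxeterMatrix.BraidMove.length_eq {B : Type*} {M : CoxeterMatrix B} {ω ω' : List B}
    (h : M.BraidMove ω ω') : ω.length = ω'.length := by
  obtain ⟨a, b, hst, h⟩ := h
  simp [length_altWord]

namespace GeneralizedChamberSystem

variable {S : Type*} {W : GeneralizedChamberSystem.{u, v} S}

namespace Gallery

theorem types_comp {x y z : W.Chamber} (p : W.Gallery x y) (q : W.Gallery y z) :
    types (Quiver.Path.comp p q) = types p ++ types q := by
  induction q with
  | nil => simp [types]
  | cons q e ih =>
    change types (Quiver.Path.comp p q) ++ [Edge.type e] = types p ++ (types q ++ [Edge.type e])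
    rw [ih, List.append_assoc]

theorem types_reverse {x y : W.Chamber} (p : W.Gallery x y) :
    types (Quiver.Path.reverse p) = (types p).reverse := by
  induction p with
  | nil => rfl
  | cons p e ih =>
    change types (Quiver.Path.comp _ _) = (types p ++ [Edge.type e]).reverse
    rw [types_comp, ih, List.reverse_append]
    rfl

/-- Opposite maximal geodesics with common ends thus bound a cycle of the shape required of a suite.
-/
theorem types_comp_reverse_eq_altWord {x y : W.Chamber} {p q : W.Gallery x y} {s t : S} {m : ℕ}
    (hp : types p = altWord s t m) (hq : types q = altWord t s m) :
    types (Quiver.Path.comp p (Quiver.Path.reverse q)) = altWord s t (2 * m) := by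
  rw [types_comp, types_reverse, hp, hq, altWord_append_reverse]

theorem length_types {x y : W.Chamber} (p : W.Gallery x y) :
    (types p).length = Quiver.Path.length p := by
  induction p with
  | nil => rfl
  | cons p e ih =>
    change (types p ++ [Edge.type e]).length = _
    rw [List.length_append, ih]
    rfl

theorem eq_nil_of_types {x : W.Chamber} {p : W.Gallery x x} (h : types p = []) :
    p = Quiver.Path.nil := by
  apply Quiver.Path.eq_nil_of_length_zero
  rw [← length_types, h]
  rfl

theorem exists_comp_of_types {x y : W.Chamber} (p : W.Gallery x y) {a b : List S}
    (h : types p = a ++ b) : ∃ (z : W.Chamber) (q : W.Gallery x z) (r : W.Gallery z y),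
      p = Quiver.Path.comp q r ∧ types q = a ∧ types r = b := by
  induction p generalizing b with
  | nil =>
    obtain ⟨rfl, rfl⟩ := List.append_eq_nil_iff.mp h.symm
    exact ⟨_, Quiver.Path.nil, Quiver.Path.nil, rfl, rfl, rfl⟩
  | cons p e ih =>
    rcases List.eq_nil_or_concat b with rfl | ⟨b, i, rfl⟩
    · exact ⟨_, Quiver.Path.cons p e, Quiver.Path.nil, rfl, by simpa using h, rfl⟩
    · rw [List.concat_eq_append, ← List.append_assoc] at h
      obtain ⟨h₁, h₂⟩ := List.append_inj' (show types p ++ [Edge.type e] = _ from h) rfl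
      obtain ⟨z, q, r, rfl, hq, hr⟩ := ih h₁
      refine ⟨z, q, Quiver.Path.cons r e, rfl, hq, ?_⟩
      change types r ++ [Edge.type e] = _
      rw [hr, h₂, List.concat_eq_append]

theorem exists_single_of_types {x y : W.Chamber} (p : W.Gallery x y) {s : S}
    (h : types p = [s]) :
    ∃ (g : W.PanelHom s x y) (hg : ¬ W.IsTrivial g), p = W.single g hg := by
  cases p with
  | nil => simp [types] at h
  | cons p e =>
    obtain ⟨h₁, h₂⟩ := List.append_inj' (show types p ++ [Edge.type e] = [] ++ [s] from h) rfl
    obtain ⟨t, g, hg⟩ := e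
    obtain rfl : t = s := by simpa using h₂
    have h₀ : Quiver.Path.length p = 0 := by rw [← length_types, h₁]; rfl
    obtain rfl := Quiver.Path.eq_of_length_zero p h₀
    obtain rfl := Quiver.Path.eq_nil_of_length_zero p h₀
    exact ⟨g, hg, rfl⟩

end Gallery

/-- Restriction only discards panel groupoids, so a gallery lifts as soon as its types lie in `J`.
This returns to the restriction the opposite geodesics that (PW1) provides in `W`. -/
theorem exists_restrictInclusion_gallery_eq {J : Set S} {x y : W.Chamber} (β : W.Gallery x y)
    {l : List J} (h : Gallery.types β = l.map Subtype.val) :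
    ∃ γ : (W.restrict J).Gallery x y, (W.restrictInclusion J).gallery γ = β ∧
      Gallery.types γ = l := by
  suffices ∃ γ : (W.restrict J).Gallery x y, (W.restrictInclusion J).gallery γ = β by
    obtain ⟨γ, hγ⟩ := this
    refine ⟨γ, hγ, List.map_injective_iff.mpr Subtype.val_injective ?_⟩
    rw [← h, ← hγ]
    exact ((W.restrictInclusion J).types_gallery γ).symm
  induction β generalizing l with
  | nil => exact ⟨Quiver.Path.nil, rfl⟩
  | cons p e ih =>
    obtain ⟨a, b, rfl, ha, hb⟩ := List.map_eq_append_iff.mp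
      (h.symm.trans (rfl : _ = Gallery.types p ++ [Edge.type e]))
    obtain ⟨γ, rfl⟩ := ih ha.symm
    obtain ⟨s, g, hg⟩ := e
    obtain ⟨j, rfl, hj⟩ := List.map_eq_singleton_iff.mp hb
    obtain rfl : j.1 = s := hj
    exact ⟨Quiver.Path.cons γ (Edge.mk (W := W.restrict J) j g hg), rfl⟩

section full

variable {X : Set W.Chamber}

theorem not_isTrivial_full {s : S} {x y : (W.full X).Chamber} {g : W.PanelHom s x.1 y.1}
    (hg : ¬ W.IsTrivial g) : ¬ (W.full X).IsTrivial (s := s) (x := x) (y := y) g := by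
  rintro ⟨h, h'⟩
  subst h
  exact hg ⟨rfl, h'⟩

theorem fullInclusion_gallery_injective {x y : (W.full X).Chamber} {γ γ' : (W.full X).Gallery x y}
    (h : (W.fullInclusion X).gallery γ = (W.fullInclusion X).gallery γ') : γ = γ' := by
  induction γ with
  | nil =>
    symm
    apply Gallery.eq_nil_of_types
    have := congrArg Gallery.types h
    rw [Morphism.types_gallery, Morphism.types_gallery, List.map_id, List.map_id] at this
    exact this.symm
  | cons p e ih =>
    cases γ' with
    | nil =>
      have := congrArg Gallery.types h
      rw [Morphism.types_gallery, Morphism.types_gallery, List.map_id, List.map_id] at this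
      exact absurd this (by simp [Gallery.types])
    | cons p' e' =>
      have h' : Quiver.Path.cons ((W.fullInclusion X).gallery p)
          ((W.fullInclusion X).prefunctor.map e) =
        Quiver.Path.cons ((W.fullInclusion X).gallery p')
          ((W.fullInclusion X).prefunctor.map e') := h
      obtain ⟨h₁, h₂, h₃⟩ := Quiver.Path.cons.inj h'
      obtain rfl := Subtype.ext h₁
      obtain rfl := ih (eq_of_heq h₂)
      have h₄ := eq_of_heq h₃
      obtain ⟨s, g, hg⟩ := e
      obtain ⟨s', g', hg'⟩ := e'
      have h₅ := (Edge.mk.injEq ..).mp h₄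
      obtain ⟨h₅, h₆⟩ := h₅
      obtain rfl : s = s' := h₅
      obtain rfl : g = g' := eq_of_heq h₆
      rfl

/-- A gallery cannot leave a set closed under edges; only its first chamber has to lie there. -/
theorem exists_fullInclusion_gallery_eq (hX : ∀ {a b : W.Chamber}, W.Edge a b → a ∈ X → b ∈ X)
    {x : (W.full X).Chamber} {b : W.Chamber} (β : W.Gallery x.1 b) :
    ∃ (hb : b ∈ X) (γ : (W.full X).Gallery x ⟨b, hb⟩), (W.fullInclusion X).gallery γ = β := by
  induction β with
  | nil => exact ⟨x.2, Quiver.Path.nil, rfl⟩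
  | cons p e ih =>
    obtain ⟨hb, γ, rfl⟩ := ih
    exact ⟨hX e hb, Quiver.Path.cons γ
      (Edge.mk (W := W.full X) e.type e.hom (not_isTrivial_full e.nontrivial)), rfl⟩

end full

end GeneralizedChamberSystem

/-! ### Reducing galleries to geodesics by homotopy -/

namespace WeylData

section

variable {S : Type*} {M : CoxeterMatrix S} {W : WeylData.{u, v} M}

theorem homotopic_of_nullHomotopic_comp_reverse {x y : W.Chamber} {β γ : W.Gallery x y}
    (h : W.NullHomotopic (Quiver.Path.comp β (Quiver.Path.reverse γ))) : W.Homotopic β γ := by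
  have h₁ := h.comp (Homotopic.refl γ)
  have h₂ := (Homotopic.refl β).comp (reverse_comp_self (W := W) γ)
  simp only [Quiver.Path.nil_comp, Quiver.Path.comp_nil, Quiver.Path.comp_assoc] at h₁ h₂
  exact h₂.symm.trans h₁

/-- Consecutive edges of the same type can be contracted. -/
theorem exists_homotopic_of_types_repeat {x y : W.Chamber} (β : W.Gallery x y) {a b : List S}
    {s : S} (h : Gallery.types β = a ++ (s :: s :: b)) :
    ∃ β' : W.Gallery x y, W.Homotopic β β' ∧
      (Gallery.types β').length < (Gallery.types β).length := by
  obtain ⟨z, p, r, rfl, hp, hr⟩ := Gallery.exists_comp_of_types β h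
  obtain ⟨z', c, q, rfl, hc, hq⟩ := Gallery.exists_comp_of_types (a := [s, s]) r hr
  obtain ⟨z'', c₁, c₂, rfl, hc₁, hc₂⟩ := Gallery.exists_comp_of_types (a := [s]) c hc
  obtain ⟨g₁, hg₁, rfl⟩ := Gallery.exists_single_of_types c₁ hc₁
  obtain ⟨g₂, hg₂, rfl⟩ := Gallery.exists_single_of_types c₂ hc₂
  suffices ∃ d : W.Gallery z z', W.Homotopic (Quiver.Path.comp (W.single g₁ hg₁)
      (W.single g₂ hg₂)) d ∧ (Gallery.types d).length < 2 by
    obtain ⟨d, hd, hd'⟩ := this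
    refine ⟨Quiver.Path.comp p (Quiver.Path.comp d q), hd.whisker p q, ?_⟩
    rw [h, Gallery.types_comp, Gallery.types_comp, hp, hq]
    simp only [List.length_append, List.length_cons]
    omega
  by_cases ht : W.IsTrivial (W.panelComp g₁ g₂)
  · obtain ⟨hz, ht⟩ := ht
    subst hz
    have e : g₂ = W.panelInv g₁ := by
      rw [W.eq_panelInv (eq_of_heq ht), W.panelInv_panelInv]
    subst e
    exact ⟨Quiver.Path.nil, Homotopic.of_move (Move.backtrack g₁ hg₁), by simp [Gallery.types]⟩
  · exact ⟨_, Homotopic.of_move (Move.shortcut g₁ g₂ hg₁ hg₂ ht),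
      by simp [Gallery.types, single]⟩

end

section

variable {S : Type*} {M : CoxeterMatrix S} {J : Set S} {V : WeylData.{u₁, v₁} (M.restrict J)}

/-- (PW1) performs the move on the subgallery concerned. The words are taken over `S` so that
Matsumoto's theorem for the full Coxeter group can be used. -/
theorem exists_homotopic_of_braidMove (hV : V.PW1) {x y : V.Chamber} (β : V.Gallery x y)
    {l : List S} (h : M.BraidMove ((Gallery.types β).map Subtype.val) l) :
    ∃ β' : V.Gallery x y, V.Homotopic β β' ∧ (Gallery.types β').map Subtype.val = l := by
  generalize hl : (Gallery.types β).map Subtype.val = l₀ at h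
  obtain ⟨a, b, hst, h0⟩ := h
  rename_i s t
  obtain ⟨a', r', hβ, rfl, hr⟩ := List.map_eq_append_iff.mp hl
  obtain ⟨c', b', rfl, hc, rfl⟩ := List.map_eq_append_iff.mp hr
  -- Since `m_{st} ≥ 2`, both letters occur in the replaced subword. They are types of edges of `β`,
  -- so they lie in `J`, and the move does not lead out of `J`.
  obtain ⟨m, hm⟩ : ∃ m, M s t = m + 2 := ⟨M s t - 2, by have := M.two_le_of_ne hst h0; omega⟩
  obtain ⟨s', t', rfl, rfl⟩ : ∃ s' t' : J, s'.1 = s ∧ t'.1 = t := by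
    rw [hm, altWord, altWord] at hc
    obtain ⟨s', d, rfl, hs, hd⟩ := List.map_eq_cons_iff.mp hc
    obtain ⟨t', d, rfl, ht, hd⟩ := List.map_eq_cons_iff.mp hd
    exact ⟨s', t', hs, ht⟩
  have hc' : c' = altWord s' t' (M s' t') := by
    apply List.map_injective_iff.mpr Subtype.val_injective
    rw [altWord_map, hc]
  obtain ⟨z, p, r, rfl, hp, hr⟩ := Gallery.exists_comp_of_types β hβ
  obtain ⟨z', ρ, q, rfl, hρ, hq⟩ := Gallery.exists_comp_of_types r hr
  obtain ⟨ρ', hρ', hh⟩ := hV s' t' z z' ρ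
    ⟨fun e => hst (congrArg Subtype.val e), h0, hρ.trans hc'⟩
  refine ⟨Quiver.Path.comp p (Quiver.Path.comp ρ' q), hh.whisker p q, ?_⟩
  have h₃ : Gallery.types ρ' = altWord t' s' (M s' t') := by
    rw [hρ'.2.2, M.symmetric s' t']; rfl
  rw [Gallery.types_comp, Gallery.types_comp, hp, hq, h₃, List.map_append, List.map_append,
    altWord_map]

theorem exists_homotopic_of_braidEquiv (hV : V.PW1) {x y : V.Chamber} (β : V.Gallery x y)
    {l : List S} (h : M.BraidEquiv ((Gallery.types β).map Subtype.val) l) :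
    ∃ β' : V.Gallery x y, V.Homotopic β β' ∧ (Gallery.types β').map Subtype.val = l ∧
      (Gallery.types β').length = (Gallery.types β).length := by
  induction h with
  | refl => exact ⟨β, Homotopic.refl β, rfl, rfl⟩
  | tail _ hm ih =>
    obtain ⟨β', hβ', rfl, hl'⟩ := ih
    obtain ⟨β'', hβ'', rfl⟩ := exists_homotopic_of_braidMove hV β' hm
    refine ⟨β'', hβ'.trans hβ'', rfl, ?_⟩
    have := hm.length_eq
    rw [List.length_map, List.length_map] at this
    omega

/-- Each gallery of the restriction is homotopic to a geodesic. -/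
theorem exists_homotopic_isReduced (hV : V.PW1) {x y : V.Chamber} (β : V.Gallery x y) :
    ∃ γ : V.Gallery x y, V.Homotopic β γ ∧
      M.toCoxeterSystem.IsReduced ((Gallery.types γ).map Subtype.val) := by
  induction hn : (Gallery.types β).length using Nat.strong_induction_on generalizing β with
  | _ n ih =>
    by_cases hr : M.toCoxeterSystem.IsReduced ((Gallery.types β).map Subtype.val)
    · exact ⟨β, Homotopic.refl β, hr⟩
    -- Braid moves keep the length, and contracting the repeated letter lowers it, so the induction
    -- on length applies.
    · obtain ⟨a, b, s, hb⟩ := M.toCoxeterSystem.exists_braidEquiv_of_not_isReduced hr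
      obtain ⟨β', hβ', ht, hl⟩ := exists_homotopic_of_braidEquiv hV β hb
      obtain ⟨a', r, hr', -, hr⟩ := List.map_eq_append_iff.mp ht
      obtain ⟨s', r, rfl, hs', hr⟩ := List.map_eq_cons_iff.mp hr
      obtain ⟨t', r, rfl, ht', -⟩ := List.map_eq_cons_iff.mp hr
      obtain rfl : s' = t' := Subtype.ext (hs'.trans ht'.symm)
      obtain ⟨β'', hβ'', hl'⟩ := exists_homotopic_of_types_repeat β' hr'
      obtain ⟨γ, hγ, hγ'⟩ := ih _ (by omega) β'' rfl
      exact ⟨γ, (hβ'.trans hβ'').trans hγ, hγ'⟩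

end

/-! ### Pulling homotopies back along a morphism -/

namespace Morphism

section

variable {S' : Type*} {S : Type*} {f : S' → S} {N : CoxeterMatrix S'} {M : CoxeterMatrix S}
  {V : WeylData.{u₁, v₁} N} {W : WeylData.{u, v} M} (ω : Morphism f V W)

theorem nullHomotopic_gallery_comp_reverse {x y : V.Chamber} {β γ : V.Gallery x y}
    (h : W.Homotopic (ω.gallery β) (ω.gallery γ)) :
    W.NullHomotopic (ω.gallery (Quiver.Path.comp β (Quiver.Path.reverse γ))) := by
  have h₁ := h.comp (Homotopic.refl (ω.gallery (Quiver.Path.reverse γ)))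
  rw [← ω.gallery_comp, ← ω.gallery_comp] at h₁
  exact h₁.trans (ω.homotopic (comp_reverse γ))

/-- Injectivity on the set of all edges also concerns edges with different ends, which is why
injectivity on chambers enters. -/
theorem isGroupoidEmbedding_induced (hinj : Function.Injective ω.chamber)
    (h : ∀ {x y : V.Chamber} {β γ : V.Gallery x y},
      W.Homotopic (ω.gallery β) (ω.gallery γ) → V.Homotopic β γ) :
    IsGroupoidEmbedding ω.induced := by
  rintro ⟨x, y, a⟩ ⟨x', y', a'⟩ e
  obtain ⟨e₁, e₂⟩ := Sigma.mk.inj e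
  obtain rfl := hinj e₁
  obtain ⟨e₃, e₄⟩ := Sigma.mk.inj (eq_of_heq e₂)
  obtain rfl := hinj e₃
  have e₅ := eq_of_heq e₄
  obtain rfl : a = a' := by
    induction a using Quotient.inductionOn with
    | h β => induction a' using Quotient.inductionOn with
      | h γ =>
        exact Quotient.sound (s := V.homotopySetoid x y)
          (h (Quotient.exact (s := W.homotopySetoid (ω.chamber x) (ω.chamber y)) e₅))
  rfl

theorem homotopic_of_isGroupoidEmbedding_induced (hω : IsGroupoidEmbedding ω.induced)
    {x y : V.Chamber} {β γ : V.Gallery x y} (h : W.Homotopic (ω.gallery β) (ω.gallery γ)) :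
    V.Homotopic β γ := by
  have e : (⟨x, y, Quotient.mk (V.homotopySetoid x y) β⟩ :
      Σ x : V.FundamentalGroupoid, Σ y : V.FundamentalGroupoid, (x ⟶ y)) =
      ⟨x, y, Quotient.mk (V.homotopySetoid x y) γ⟩ := by
    apply hω
    have e' : ω.induced.map (X := x) (Y := y) (Quotient.mk (V.homotopySetoid x y) β) =
        ω.induced.map (X := x) (Y := y) (Quotient.mk (V.homotopySetoid x y) γ) :=
      Quotient.sound (s := W.homotopySetoid (ω.chamber x) (ω.chamber y)) h
    dsimp only
    rw [e']
  have e₁ := eq_of_heq (Sigma.mk.inj (eq_of_heq (Sigma.mk.inj e).2)).2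
  exact Quotient.exact (s := V.homotopySetoid x y) e₁

end

variable {S : Type*} {M : CoxeterMatrix S} {J : Set S} {V : WeylData.{u₁, v₁} (M.restrict J)}
  {W : WeylData.{u, v} M} (ω : Morphism (Subtype.val : J → S) V W)

/-- The core of the argument. Replace `β` by a homotopic `γ` of reduced type; in `W` it is a
geodesic homotopic to the trivial geodesic, so (W) makes its type a reduced word for 1, which is
empty. -/
theorem nullHomotopic_of_nullHomotopic_gallery (hV : V.PW1) (hW : W.PropertyW) {x : V.Chamber}
    {β : V.Gallery x x} (h : W.NullHomotopic (ω.gallery β)) : V.NullHomotopic β := by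
  obtain ⟨γ, hγ, hr⟩ := exists_homotopic_isReduced hV β
  refine hγ.trans ?_
  have hr' : W.IsGeodesic (ω.gallery γ) := by
    rw [IsGeodesic, ω.types_gallery]; exact hr
  have hnil : W.IsGeodesic (Quiver.Path.nil : W.Gallery (ω.chamber x) (ω.chamber x)) := by
    simp [IsGeodesic, Gallery.types, CoxeterSystem.IsReduced]
  have hl := hW _ _ _ _ hr' hnil ((ω.homotopic hγ).symm.trans h)
  have hlen : (Gallery.types (ω.gallery γ)).length = 0 := by
    rw [← hr'.eq]
    change M.toCoxeterSystem.length (W.wLength _) = 0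
    rw [hl]
    simp [wLength, Gallery.types]
  rw [ω.types_gallery, List.length_map, List.length_eq_zero_iff] at hlen
  rw [Gallery.eq_nil_of_types hlen]
  exact Homotopic.refl _

theorem homotopic_of_homotopic_gallery (hV : V.PW1) (hW : W.PropertyW) {x y : V.Chamber}
    {β γ : V.Gallery x y} (h : W.Homotopic (ω.gallery β) (ω.gallery γ)) : V.Homotopic β γ :=
  homotopic_of_nullHomotopic_comp_reverse (ω.nullHomotopic_of_nullHomotopic_gallery hV hW
    (ω.nullHomotopic_gallery_comp_reverse h))

end Morphism

/-! ### (PW1) for the two restrictions -/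

section

variable {S : Type u₃} {M : CoxeterMatrix S} {W : WeylData.{u, v} M}

/-- A maximal geodesic of the restriction is homotopic in `W` to an opposite one in the
restriction. -/
theorem exists_restrictInclusion_homotopic (hW : W.PW1) {J : Set S} {s t : J} {x y : W.Chamber}
    {ρ : (W.toGeneralizedChamberSystem.restrict J).Gallery x y} (hst : s ≠ t)
    (h0 : M s t ≠ 0) (hρ : Gallery.types ρ = altWord s t (M s t)) :
    ∃ ρ' : (W.toGeneralizedChamberSystem.restrict J).Gallery x y,
      Gallery.types ρ' = altWord t s (M t s) ∧
      W.Homotopic ((W.toGeneralizedChamberSystem.restrictInclusion J).gallery ρ)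
        ((W.toGeneralizedChamberSystem.restrictInclusion J).gallery ρ') := by
  obtain ⟨ρ', ⟨-, -, h'⟩, hh⟩ := hW s t x y
    ((W.toGeneralizedChamberSystem.restrictInclusion J).gallery ρ)
    ⟨fun e => hst (Subtype.ext e), h0,
      (GeneralizedChamberSystem.Morphism.types_gallery
        (W.toGeneralizedChamberSystem.restrictInclusion J) ρ).trans
          ((congrArg _ hρ).trans (altWord_map _ s t _))⟩
  rw [← altWord_map] at h'
  obtain ⟨ρ', rfl, ht⟩ := exists_restrictInclusion_gallery_eq ρ' h'
  exact ⟨ρ', ht, hh⟩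

/-- The geodesic followed by the inverse of its opposite is a null-homotopic cycle in `W`, that is,
a suite; saturation makes it a defining suite. -/
theorem saturation_restrict_pw1 (hW : W.PW1) (J : Set S) : (W.saturation.restrict J).PW1 := by
  rintro s t x y ρ ⟨hst, h0, hρ⟩
  obtain ⟨ρ', hρ', hh⟩ := exists_restrictInclusion_homotopic hW hst h0 hρ
  refine ⟨ρ', ⟨hst.symm, ?_, hρ'⟩, ?_⟩
  · change M t s ≠ 0
    rwa [M.symmetric]
  · apply homotopic_of_nullHomotopic_comp_reverse
    refine Homotopic.of_move (Move.suite (s := s) (t := t) _ ⟨fun e => hst (Subtype.ext e), h0, ?_,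
      (W.saturatedInternal J).nullHomotopic_gallery_comp_reverse hh⟩)
    refine (GeneralizedChamberSystem.Morphism.types_gallery
      (W.toGeneralizedChamberSystem.restrictInclusion J) _).trans ?_
    exact (congrArg _ (Gallery.types_comp_reverse_eq_altWord
      (W := W.toGeneralizedChamberSystem.restrict J) hρ
      (hρ'.trans (congrArg _ (M.symmetric t s))))).trans (altWord_map _ s t _)

theorem restrict_pw1_of_isGroupoidEmbedding (hW : W.PW1) {J : Set S}
    (h : IsGroupoidEmbedding (W.internal J).induced) : (W.restrict J).PW1 := by
  rintro s t x y ρ ⟨hst, h0, hρ⟩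
  obtain ⟨ρ', hρ', hh⟩ := exists_restrictInclusion_homotopic hW hst h0 hρ
  refine ⟨ρ', ⟨hst.symm, ?_, hρ'⟩, ?_⟩
  · change M t s ≠ 0
    rwa [M.symmetric]
  · exact (W.internal J).homotopic_of_isGroupoidEmbedding_induced h hh

/-! ### Homotopy inside a connected component -/

variable {X : Set W.Chamber}

theorem exists_full_move (hX : ∀ {a b : W.Chamber}, W.Edge a b → a ∈ X → b ∈ X)
    {a b : W.Chamber} {c d : W.Gallery a b} (h : W.Move c d) (ha : a ∈ X) (hb : b ∈ X) :
    ∃ c' d' : (W.full X).Gallery ⟨a, ha⟩ ⟨b, hb⟩, (W.full X).Move c' d' ∧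
      (W.toGeneralizedChamberSystem.fullInclusion X).gallery c' = c ∧
      (W.toGeneralizedChamberSystem.fullInclusion X).gallery d' = d := by
  induction h with
  | @backtrack s x y g hg =>
    have hy : y ∈ X := hX (Edge.mk s g hg) ha
    exact ⟨_, _, Move.backtrack (W := W.full X) (s := s) (x := ⟨x, ha⟩) (y := ⟨y, hy⟩) g
      (not_isTrivial_full hg), rfl, rfl⟩
  | @shortcut s x y z g k hg hk hgk =>
    have hy : y ∈ X := hX (Edge.mk s g hg) ha
    exact ⟨_, _, Move.shortcut (W := W.full X) (s := s) (x := ⟨x, ha⟩) (y := ⟨y, hy⟩)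
      (z := ⟨z, hb⟩) g k (not_isTrivial_full hg) (not_isTrivial_full hk)
      (not_isTrivial_full hgk), rfl, rfl⟩
  | @suite s t x θ hθ =>
    obtain ⟨_, θ', rfl⟩ := exists_fullInclusion_gallery_eq
      (W := W.toGeneralizedChamberSystem) hX (x := ⟨x, ha⟩) θ
    exact ⟨θ', Quiver.Path.nil, Move.suite (W := W.full X) (s := s) (t := t) θ' hθ, rfl, rfl⟩

/-- Galleries in a union of connected components which are homotopic are homotopic there. -/
theorem full_homotopic (hX : ∀ {a b : W.Chamber}, W.Edge a b → a ∈ X → b ∈ X)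
    {x y : (W.full X).Chamber} {γ γ' : (W.full X).Gallery x y}
    (h : W.Homotopic ((W.toGeneralizedChamberSystem.fullInclusion X).gallery γ)
      ((W.toGeneralizedChamberSystem.fullInclusion X).gallery γ')) :
    (W.full X).Homotopic γ γ' := by
  generalize hβ : (W.toGeneralizedChamberSystem.fullInclusion X).gallery γ = β at h
  generalize hβ' : (W.toGeneralizedChamberSystem.fullInclusion X).gallery γ' = β' at h
  induction h generalizing γ γ' with
  | rel β β' h =>
    obtain ⟨p, c, d, q, hm⟩ := h
    obtain ⟨ha, p', rfl⟩ := exists_fullInclusion_gallery_eq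
      (W := W.toGeneralizedChamberSystem) hX (x := x) p
    obtain ⟨hb, -, -⟩ := exists_fullInclusion_gallery_eq
      (W := W.toGeneralizedChamberSystem) hX (x := ⟨_, ha⟩) c
    obtain ⟨hy, q', rfl⟩ := exists_fullInclusion_gallery_eq
      (W := W.toGeneralizedChamberSystem) hX (x := ⟨_, hb⟩) q
    obtain ⟨c', d', hm', rfl, rfl⟩ := exists_full_move hX hm ha hb
    have e₁ : γ = Quiver.Path.comp p' (Quiver.Path.comp c' q') := by
      apply fullInclusion_gallery_injective (W := W.toGeneralizedChamberSystem)
      exact hβ.trans ((GeneralizedChamberSystem.Morphism.gallery_comp _ p' _).trans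
        (congrArg _ (GeneralizedChamberSystem.Morphism.gallery_comp _ c' q'))).symm
    have e₂ : γ' = Quiver.Path.comp p' (Quiver.Path.comp d' q') := by
      apply fullInclusion_gallery_injective (W := W.toGeneralizedChamberSystem)
      exact hβ'.trans ((GeneralizedChamberSystem.Morphism.gallery_comp _ p' _).trans
        (congrArg _ (GeneralizedChamberSystem.Morphism.gallery_comp _ d' q'))).symm
    rw [e₁, e₂]
    exact (Homotopic.of_move hm').whisker p' q'
  | refl β =>
    rw [fullInclusion_gallery_injective (hβ.trans hβ'.symm)]
    exact Homotopic.refl _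
  | symm β β' _ ih => exact (ih hβ' hβ).symm
  | trans β δ β' _ _ ih ih' =>
    -- The intermediate gallery of `W` begins in `X`, so it lifts and both halves of the homotopy
    -- can be lifted separately.
    obtain ⟨_, δ', hδ⟩ := exists_fullInclusion_gallery_eq
      (W := W.toGeneralizedChamberSystem) hX (x := x) δ
    exact (ih hβ hδ).trans (ih' hδ hβ')

theorem component_homotopic {C : W.Chamber} {x y : (W.component C).Chamber}
    {γ γ' : (W.component C).Gallery x y}
    (h : W.Homotopic ((W.toGeneralizedChamberSystem.fullInclusion _).gallery γ)
      ((W.toGeneralizedChamberSystem.fullInclusion _).gallery γ')) :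
    (W.component C).Homotopic γ γ' :=
  full_homotopic (X := {D | Nonempty (W.Gallery C D)})
    (fun e h => h.map fun p => Quiver.Path.cons p e) h

end

end WeylData

/-! ### The corollary -/

theorem mainTheorem11 {S : Type u₃} (M : CoxeterMatrix S) (W : WeylData.{u, v} M)
    (hW : W.IsWeylGraph) (J : Set S) :
    (IsGroupoidEmbedding (W.saturatedInternal J).induced ∧
      ∀ (C : (W.saturation.restrict J).Chamber) (x y : ((W.saturation.restrict J).component C).Chamber)
        (γ γ' : ((W.saturation.restrict J).component C).Gallery x y),
        W.IsGeodesic (W.saturation.ofResidue J C γ) →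
        W.IsGeodesic (W.saturation.ofResidue J C γ') →
        W.Homotopic (W.saturation.ofResidue J C γ) (W.saturation.ofResidue J C γ') →
        ((W.saturation.restrict J).component C).Homotopic γ γ') ∧
    (IsGroupoidEmbedding (W.internal J).induced ↔ (W.restrict J).PW1) ∧
    ((W.restrict J).PW1 →
      ∀ (C : (W.restrict J).Chamber) (x y : ((W.restrict J).component C).Chamber)
        (γ γ' : ((W.restrict J).component C).Gallery x y),
        W.IsGeodesic (W.ofResidue J C γ) →
        W.IsGeodesic (W.ofResidue J C γ') →
        W.Homotopic (W.ofResidue J C γ) (W.ofResidue J C γ') →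
        ((W.restrict J).component C).Homotopic γ γ') := by
  have hsat := WeylData.saturation_restrict_pw1 hW.pw1 J
  refine ⟨⟨?_, ?_⟩, ⟨?_, ?_⟩, ?_⟩
  · exact (W.saturatedInternal J).isGroupoidEmbedding_induced (fun _ _ h => h)
      ((W.saturatedInternal J).homotopic_of_homotopic_gallery hsat hW.propertyW)
  · intro C x y γ γ' _ _ h
    exact WeylData.component_homotopic
      ((W.saturatedInternal J).homotopic_of_homotopic_gallery hsat hW.propertyW h)
  · exact WeylData.restrict_pw1_of_isGroupoidEmbedding hW.pw1
  · intro hJ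
    exact (W.internal J).isGroupoidEmbedding_induced (fun _ _ h => h)
      ((W.internal J).homotopic_of_homotopic_gallery hJ hW.propertyW)
  · intro hJ C x y γ γ' _ _ h
    exact WeylData.component_homotopic
      ((W.internal J).homotopic_of_homotopic_gallery hJ hW.propertyW h)
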